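/- **Machines.** Let $\Sigma$ be a finite alphabet and $k\ge 1$. On input $w\in\Sigma^*$ the tape carries $\tilde w=¢\,w\,\$$ with end-markers $¢,\$\notin\Sigma$. A one-way $k$-head finite automaton has a finite state set $Q$ with an initial state and $k$ heads, all initially on $¢$. In each step, depending on the state and on the $k$ scanned symbols, it enters a new state and each head either stays or moves one square to the right, never beyond $\$$. * A **1D$k$FA** is deterministic: it has a partial transition function and accepts $w$ if it halts (its transition is undefined) in an accepting state. * A **1P$k$FA** is probabilistic: each defined transition is drawn from a probability distribution, and $f_{\mathcal M}(w)$ is the probability that the automaton ever halts in an accepting state. * A **1Q$k$FA** is quantum: it has a finite register alphabet $\Omega=\Omega_a\sqcup\Omega_r\sqcup\Omega_n$ and amplitudes $\delta(q,\sigma,p,\omega)\in\mathbb C$ for being in state $q$, scanning $\sigma\in(\Sigma\cup\{¢,\$\})^k$, entering state $p$ and writing $\omega\in\Omega$; the head moves are determined by $p$. For $w\in\Sigma^*$ let $E_\omega$ be the matrix of the resulting transition amplitudes between the configurations in $Q\times\{1,\dots,|\tilde w|\}^k$ that write $\omega$; well-formedness requires $\sum_{\omega\in\Omega}E_\omega^\dagger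 E_\omega=I$ for every $w$. The computation starts in $\rho_0=|c_0\rangle\langle c_0|$ with $c_0$ the initial configuration. In each step the register is measured with respect to $\Omega_a,\Omega_r,\Omega_n$: the automaton accepts, rejects or continues accordingly, and the register is then discarded and reset. Thus $\rho_{t+1}=\sum_{\omega\in\Omega_n}E_\omega\rho_tE_\omega^\dagger$ and $f_{\mathcal M}(w)=\sum_{t\ge 0}\sum_{\omega\in\Omega_a}\operatorname{tr}(E_\omega\rho_tE_\omega^\dagger)$. A probabilistic or quantum automaton $\mathcal M$ recognizes $L\subseteq\Sigma^*$ with error bound $\epsilon$ if $f_{\mathcal M}(w)\ge 1-\epsilon$ for all $w\in L$ and $f_{\mathcal M}(w)\le\epsilon$ for all $w\notin L$. **Statement.** Let $\epsilon\in(0,\tfrac12)$ and let $\Sigma$ be a finite alphabet. 1. For every $k\ge 1$, every language over $\Sigma$ recognized by a 1D$k$FA is recognized by a 1Q$k$FA with error bound $\epsilon$. If $|\Sigma|\ge 2$, the inclusion is proper: the class of languages over $\Sigma$ recognized by 1D$k$FAs is a proper subset of the class of languages over $\Sigma$ recognized by 1Q$k$FAs with error bound $\epsilon$. 2. For every $k\ge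 3$, every language over $\Sigma$ recognized by a 1D$k$FA is recognized by a 1P$k$FA with error bound $\epsilon$. If $|\Sigma|\ge 2$, the inclusion is proper: the class of languages over $\Sigma$ recognized by 1D$k$FAs is a proper subset of the class of languages over $\Sigma$ recognized by 1P$k$FAs with error bound $\epsilon$. -/

import Mathlib

open scoped ENNReal Matrix

namespace MultiheadFA

/-- The symbols on the input tape: the letters of the input alphabet `Γ` and the two end-markers. -/
inductive TapeSymbol (Γ : Type) : Type
  | leftEnd : TapeSymbol Γ
  | letter (a : Γ) : TapeSymbol Γ
  | rightEnd : TapeSymbol Γ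

/-- The tape content `¢ w $` on input `w`. -/
def tape {Γ : Type} (w : List Γ) : List (TapeSymbol Γ) :=
  TapeSymbol.leftEnd :: (w.map TapeSymbol.letter ++ [TapeSymbol.rightEnd])

/-- The squares of the tape `¢ w $` (the first one has index `0`). -/
abbrev Pos {Γ : Type} (w : List Γ) : Type := Fin (tape w).length

/-- The square carrying the left end-marker. -/
def startPos {Γ : Type} (w : List Γ) : Pos w := ⟨0, by simp [tape]⟩

/-- The symbols read by `k` heads that stand on the squares `x`. -/
def scan {Γ : Type} {k : ℕ} (w : List Γ) (x : Fin k → Pos w) : Fin k → TapeSymbol Γ :=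
  fun i => (tape w).get (x i)

/-- One head either stays (`false`) or moves one square to the right (`true`);
there is no move to the right from the right end-marker. -/
def advance {Γ : Type} (w : List Γ) (x : Pos w) (d : Bool) : Pos w :=
  if h : d = true ∧ (x : ℕ) + 1 < (tape w).length then ⟨x + 1, h.2⟩ else x

/-- One-way deterministic finite automata with `k` input heads. The transition function is partial:
where it is undefined, the automaton halts. -/
structure DetFA (Γ : Type) (k : ℕ) where
  Q : Type
  [fintypeQ : Fintype Q]
  δ : Q → (Fin k → TapeSymbol Γ) → Option (Q × (Fin k → Bool))
  q₀ : Q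
  Qa : Set Q

namespace DetFA

variable {Γ : Type} {k : ℕ} (M : DetFA Γ k)

/-- Configurations on input `w`: the state and the positions of the heads. -/
abbrev Config (w : List Γ) : Type := M.Q × (Fin k → Pos w)

/-- The initial configuration: all heads on the left end-marker. -/
def init (w : List Γ) : M.Config w := (M.q₀, fun _ => startPos w)

/-- One step; a halted configuration is kept. -/
def step (w : List Γ) (c : M.Config w) : M.Config w :=
  match M.δ c.1 (scan w c.2) with
  | none => c
  | some pd => (pd.1, fun i => advance w (c.2 i) (pd.2 i))

/-- The automaton has halted in an accepting state. -/
def HaltedAccepting (w : List Γ) (c : M.Config w) : Prop :=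
  M.δ c.1 (scan w c.2) = none ∧ c.1 ∈ M.Qa

/-- The language of the inputs on which the automaton halts in an accepting state. -/
def language : Language Γ :=
  {w | ∃ t : ℕ, M.HaltedAccepting w ((M.step w)^[t] (M.init w))}

end DetFA

/-- One-way probabilistic finite automata with `k` input heads: as the deterministic ones, but each
transition is drawn from a probability distribution. -/
structure ProbFA (Γ : Type) (k : ℕ) where
  Q : Type
  [fintypeQ : Fintype Q]
  δ : Q → (Fin k → TapeSymbol Γ) → Option (PMF (Q × (Fin k → Bool)))
  q₀ : Q
  Qa : Set Q

namespace ProbFA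

variable {Γ : Type} {k : ℕ} (M : ProbFA Γ k)

/-- Configurations on input `w`: the state and the positions of the heads. -/
abbrev Config (w : List Γ) : Type := M.Q × (Fin k → Pos w)

/-- The initial configuration: all heads on the left end-marker. -/
def init (w : List Γ) : M.Config w := (M.q₀, fun _ => startPos w)

/-- The distribution of the next configuration; a halted configuration is kept. -/
noncomputable def step (w : List Γ) (c : M.Config w) : PMF (M.Config w) :=
  match M.δ c.1 (scan w c.2) with
  | none => PMF.pure c
  | some μ => μ.map fun pd => (pd.1, fun i => advance w (c.2 i) (pd.2 i))

/-- The distribution of the configuration after `t` steps. -/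
noncomputable def run (w : List Γ) : ℕ → PMF (M.Config w)
  | 0 => PMF.pure (M.init w)
  | t + 1 => (run w t).bind (M.step w)

/-- The automaton has halted in an accepting state. -/
def HaltedAccepting (w : List Γ) (c : M.Config w) : Prop :=
  M.δ c.1 (scan w c.2) = none ∧ c.1 ∈ M.Qa

/-- The probability that the automaton ever halts in an accepting state. The probabilities of having
done so within `t` steps increase with `t`, so their supremum is their limit. -/
noncomputable def acceptProb (w : List Γ) : ℝ≥0∞ :=
  ⨆ t : ℕ, (M.run w t).toOuterMeasure {c | M.HaltedAccepting w c}

end ProbFA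

/-- The outcomes of the measurement of the register. -/
inductive Outcome : Type
  | accept : Outcome
  | reject : Outcome
  | continue : Outcome
  deriving DecidableEq

/-- The data of a one-way quantum finite automaton with `k` input heads and register alphabet `Ω`.
`δ q σ p ω` is the amplitude with which the automaton, in state `q` and reading the symbols `σ`,
enters the state `p` and writes `ω` on the register. The moves of the heads are determined by the
state that is entered. `outcome` is the partition of `Ω` into the accepting, the rejecting and the
non-halting symbols. -/
structure QuantumTable (Γ : Type) (k : ℕ) where
  Q : Type
  Ω : Type
  [fintypeQ : Fintype Q]
  [decEqQ : DecidableEq Q]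
  [fintypeΩ : Fintype Ω]
  δ : Q → (Fin k → TapeSymbol Γ) → Q → Ω → ℂ
  move : Q → Fin k → Bool
  q₀ : Q
  outcome : Ω → Outcome

attribute [instance] QuantumTable.fintypeQ QuantumTable.decEqQ QuantumTable.fintypeΩ

namespace QuantumTable

variable {Γ : Type} {k : ℕ} (M : QuantumTable Γ k)

/-- Configurations on input `w`: the state and the positions of the heads. -/
abbrev Config (w : List Γ) : Type := M.Q × (Fin k → Pos w)

/-- The initial configuration: all heads on the left end-marker. -/
def init (w : List Γ) : M.Config w := (M.q₀, fun _ => startPos w)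

/-- The matrix `E_ω` of the transitions between the configurations on input `w` that write `ω`:
its entry at `(c', c)` is the amplitude of the transition from `c` to `c'`. -/
noncomputable def E (w : List Γ) (ω : M.Ω) : Matrix (M.Config w) (M.Config w) ℂ :=
  Matrix.of fun c' c =>
    if ∀ i, (c'.2 i : ℕ) = (c.2 i : ℕ) + (M.move c'.1 i).toNat then
      M.δ c.1 (scan w c.2) c'.1 ω
    else 0

/-- For every input, the columns of the stacked matrices `E_ω` are orthonormal. In particular no
head ever leaves the tape. -/
def WellFormed : Prop :=
  ∀ w : List Γ, ∑ ω : M.Ω, (M.E w ω)ᴴ * M.E w ω = 1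

/-- The (unnormalized) density matrix after `t` steps of the part of the computation that has not
halted: in each step the register is measured, and the computation goes on for the outcome
`Outcome.continue`, with the register discarded and reset. -/
noncomputable def density (w : List Γ) : ℕ → Matrix (M.Config w) (M.Config w) ℂ
  | 0 => Matrix.single (M.init w) (M.init w) 1
  | t + 1 => ∑ ω with M.outcome ω = Outcome.continue, M.E w ω * density w t * (M.E w ω)ᴴ

/-- The probability that the automaton halts and accepts exactly in step `t + 1`. -/
noncomputable def acceptProbAt (w : List Γ) (t : ℕ) : ℝ :=
  ∑ ω with M.outcome ω = Outcome.accept,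
    (Matrix.trace (M.E w ω * M.density w t * (M.E w ω)ᴴ)).re

/-- The probability that the automaton ever accepts `w`. -/
noncomputable def acceptProb (w : List Γ) : ℝ≥0∞ :=
  ∑' t : ℕ, ENNReal.ofReal (M.acceptProbAt w t)

end QuantumTable

/-- One-way quantum finite automata with `k` input heads. -/
structure QuantumFA (Γ : Type) (k : ℕ) extends QuantumTable Γ k where
  wellFormed : toQuantumTable.WellFormed

/-- A machine with acceptance probability `f w` on each input `w` recognizes `L` with error
bound `ε`. -/
def RecognizesWithError {Γ : Type} (f : List Γ → ℝ≥0∞) (L : Language Γ) (ε : ℝ) : Prop :=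
  (∀ w ∈ L, ENNReal.ofReal (1 - ε) ≤ f w) ∧ (∀ w ∉ L, f w ≤ ENNReal.ofReal ε)

/-- The languages over `Γ` recognized by one-way deterministic `k`-head finite automata. -/
def detClass (Γ : Type) (k : ℕ) : Set (Language Γ) :=
  {L | ∃ M : DetFA Γ k, M.language = L}

/-- The languages over `Γ` recognized by one-way probabilistic `k`-head finite automata with error
bound `ε`. -/
def probClass (Γ : Type) (k : ℕ) (ε : ℝ) : Set (Language Γ) :=
  {L | ∃ M : ProbFA Γ k, RecognizesWithError M.acceptProb L ε}

/-- The languages over `Γ` recognized by one-way quantum `k`-head finite automata with error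
bound `ε`. -/
def quantumClass (Γ : Type) (k : ℕ) (ε : ℝ) : Set (Language Γ) :=
  {L | ∃ M : QuantumFA Γ k, RecognizesWithError M.acceptProb L ε}

end MultiheadFA

/-! The inclusions are simulations. A deterministic automaton is a probabilistic one without random
choices, and it becomes a well-formed quantum one once each step writes the state it leaves on the
register. Properness is witnessed in both cases by one language, `balanced α m` with m = 2k² + 1.

Upper bounds. For a word with excesses e_i let P(j) = ∑ e_i j^(i+1). It vanishes identically if the
word is balanced; otherwise it takes each value at most m times (`card_filter_sum_mul_pow_eq_le`).
With N > m/ε points j < N this yields error at most ε. A probabilistic automaton draws j and tests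
P(j) = 0 deterministically, keeping the running sum in the distance between two heads
(`linearTest`). A quantum automaton needs one head only: it sends N runners in superposition,
delayed so that runner j reaches the right end-marker at time P(j) + C, and there accepts the
component along the uniform superposition. If g_t runners arrive at time t, they are accepted with
probability (g_t/N)². The total is 1 when all arrive together, and at most m/N when no more than m
ever do.

Lower bound. Cut part of the input into 2k² + 2 blocks. A pair of one-way heads visits pairs of
blocks in monotone order, so the k² pairs of heads cannot bring all pairs of blocks together: some
two blocks are never scanned simultaneously (`exists_separates`). With n rows per block, the
contents of two blocks can be chosen in (n+1)^(2m) ways, whereas their column totals and the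
configurations in which heads first enter them take only O(n^(m+2k²)) values. As m > 2k², two
different balanced words agree in all these data and outside the two blocks, apart from block
contents. The accepting runs can then be spliced into one on a hybrid word (`tapeAccepts_mix`), but
the hybrid can be balanced only if the two words coincide (`eq_of_entry_eq`). -/

namespace MultiheadFA

/-! ### Squares of the tape and moves of a head -/

section Tape

variable {Γ : Type} (w : List Γ)

theorem length_tape : (tape w).length = w.length + 2 := by simp [tape]

theorem tape_getElem_zero (h : 0 < (tape w).length) : (tape w)[0] = TapeSymbol.leftEnd := rfl

theorem tape_getElem_succ_of_lt {p : ℕ} (hp : p < w.length) (h : p + 1 < (tape w).length) :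
    (tape w)[p + 1] = TapeSymbol.letter w[p] := by
  simp [tape, hp]

theorem tape_getElem_length_succ (h : w.length + 1 < (tape w).length) :
    (tape w)[w.length + 1] = TapeSymbol.rightEnd := by
  simp [tape]

theorem tape_getElem_eq_rightEnd_iff {p : ℕ} (h : p < (tape w).length) :
    (tape w)[p] = TapeSymbol.rightEnd ↔ p = w.length + 1 := by
  constructor
  · intro hp
    have h' := h
    rw [length_tape] at h'
    rcases p with _ | p
    · rw [tape_getElem_zero] at hp; cases hp
    · by_contra hne
      rw [tape_getElem_succ_of_lt w (by omega)] at hp; cases hp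
  · rintro rfl
    exact tape_getElem_length_succ w h

theorem advance_false (x : Pos w) : advance w x false = x := by simp [advance]

theorem val_lt_length_add_two (x : Pos w) : (x : ℕ) < w.length + 2 :=
  x.2.trans_eq (length_tape w)

theorem val_advance (x : Pos w) (d : Bool) :
    (advance w x d : ℕ) = if d = true ∧ (x : ℕ) < w.length + 1 then (x : ℕ) + 1 else x := by
  have hiff : (d = true ∧ (x : ℕ) + 1 < (tape w).length) ↔ d = true ∧ (x : ℕ) < w.length + 1 := by
    have := length_tape w
    exact and_congr_right fun _ => by omega
  unfold advance
  simp only [hiff]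
  split_ifs <;> rfl

theorem advance_of_rightEnd {x : Pos w} (hx : (tape w).get x = TapeSymbol.rightEnd) (d : Bool) :
    advance w x d = x := by
  rw [List.get_eq_getElem, tape_getElem_eq_rightEnd_iff] at hx
  apply Fin.ext
  rw [val_advance, if_neg]
  omega

theorem val_advance_of_ne_rightEnd {x : Pos w} {d : Bool}
    (h : (tape w).get x = TapeSymbol.rightEnd → d = false) :
    (advance w x d : ℕ) = x + d.toNat := by
  rw [List.get_eq_getElem, tape_getElem_eq_rightEnd_iff] at h
  have hx := val_lt_length_add_two w x
  rw [val_advance]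
  rcases d with _ | _
  · simp
  · have : (x : ℕ) ≠ w.length + 1 := fun h' => by simpa using h h'
    rw [if_pos ⟨rfl, by omega⟩]; rfl

end Tape

/-! ### Local criteria for well-formedness, and pure-state evolution -/

namespace QuantumTable

variable {Γ : Type} {k : ℕ} (M : QuantumTable Γ k)

/-- No transition moves a head to the right while it scans the right end-marker. -/
def StaysOnTape : Prop :=
  ∀ q σ p ω, M.δ q σ p ω ≠ 0 → ∀ i, σ i = TapeSymbol.rightEnd → M.move p i = false

variable {M}

/-- The definition of `E` adds the move to the position, while `advance` stops at the right
end-marker. They disagree only where a head would leave the tape, and there the amplitude is zero.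
-/
theorem StaysOnTape.E_apply (hM : M.StaysOnTape) (w : List Γ) (ω : M.Ω) (c' c : M.Config w) :
    M.E w ω c' c = if c'.2 = fun i => advance w (c.2 i) (M.move c'.1 i) then
      M.δ c.1 (scan w c.2) c'.1 ω else 0 := by
  by_cases h0 : M.δ c.1 (scan w c.2) c'.1 ω = 0
  · simp [E, h0]
  · have h := hM _ _ _ _ h0
    have : (∀ i, (c'.2 i : ℕ) = (c.2 i : ℕ) + (M.move c'.1 i).toNat) ↔
        c'.2 = fun i => advance w (c.2 i) (M.move c'.1 i) := by
      rw [funext_iff]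
      refine forall_congr' fun i => ?_
      rw [Fin.ext_iff, val_advance_of_ne_rightEnd w (h i)]
    simp [E, this]

/-- The head moves depend only on the state entered, so a configuration determines the head
positions of its predecessors. Columns with different head positions thus have disjoint supports,
and for equal positions orthonormality is a condition on the transition table alone. -/
theorem wellFormed_of_local (hM : M.StaysOnTape)
    (horth : ∀ σ q q', ∑ p, ∑ ω, star (M.δ q σ p ω) * M.δ q' σ p ω = if q = q' then 1 else 0) :
    M.WellFormed := by
  intro w
  ext c c'
  simp only [Matrix.sum_apply, Matrix.mul_apply, Matrix.conjTranspose_apply, Matrix.one_apply]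
  by_cases hx : c.2 = c'.2
  · obtain ⟨q, x⟩ := c
    obtain ⟨q', x'⟩ := c'
    obtain rfl : x = x' := hx
    have h := horth (scan w x) q q'
    rw [Finset.sum_comm] at h
    simp only [Prod.mk.injEq, and_true]
    rw [← h]
    refine Finset.sum_congr rfl fun ω _ => ?_
    rw [Fintype.sum_prod_type]
    refine Finset.sum_congr rfl fun p _ => ?_
    simp only [hM.E_apply]
    rw [Finset.sum_eq_single (fun i => advance w (x i) (M.move p i))]
    · simp
    · intro y _ hy
      rw [if_neg hy, star_zero, zero_mul]
    · simp
  · rw [if_neg (fun h => hx (by rw [h]))]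
    refine Finset.sum_eq_zero fun ω _ => Finset.sum_eq_zero fun a _ => ?_
    simp only [E, Matrix.of_apply]
    split_ifs with h1 h2
    · exact absurd (funext fun i => Fin.ext (by have := h1 i; have := h2 i; omega)) hx
    all_goals simp

theorem mul_vecMulVec_star_mul {n : Type*} [Fintype n] (A : Matrix n n ℂ) (v : n → ℂ) :
    A * Matrix.vecMulVec v (star v) * Aᴴ = Matrix.vecMulVec (A *ᵥ v) (star (A *ᵥ v)) := by
  rw [Matrix.mul_vecMulVec, Matrix.vecMulVec_mul, Matrix.star_mulVec]

/-- As long as at most one non-halting register symbol is written in each step, the state of the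
part of the computation that has not halted is pure. -/
theorem density_eq_vecMulVec (w : List Γ) (ψ : ℕ → M.Config w → ℂ) (g : ℕ → M.Ω)
    (h0 : ψ 0 = Pi.single (M.init w) 1) (hg : ∀ t, M.outcome (g t) = Outcome.continue)
    (hstep : ∀ t, M.E w (g t) *ᵥ ψ t = ψ (t + 1))
    (hother : ∀ t ω, M.outcome ω = Outcome.continue → ω ≠ g t → M.E w ω *ᵥ ψ t = 0) (t : ℕ) :
    M.density w t = Matrix.vecMulVec (ψ t) (star (ψ t)) := by
  classical
  induction t with
  | zero =>
    rw [h0, density]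
    ext a b
    simp only [Matrix.single_apply, Matrix.vecMulVec_apply, Pi.star_apply, Pi.single_apply]
    by_cases ha : a = M.init w <;> by_cases hb : b = M.init w <;> simp [ha, hb, eq_comm]
  | succ t ih =>
    rw [density, ih, Finset.sum_eq_single_of_mem (g t) (by simp [hg]), mul_vecMulVec_star_mul,
      hstep]
    intro ω hω hne
    rw [mul_vecMulVec_star_mul, hother t ω (by simpa using hω) hne, Matrix.zero_vecMulVec]

theorem acceptProbAt_of_density_eq {w : List Γ} {t : ℕ} {ψ : M.Config w → ℂ}
    (h : M.density w t = Matrix.vecMulVec ψ (star ψ)) :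
    M.acceptProbAt w t = ∑ ω with M.outcome ω = Outcome.accept, ∑ c, ‖(M.E w ω *ᵥ ψ) c‖ ^ 2 := by
  rw [acceptProbAt, h]
  refine Finset.sum_congr rfl fun ω _ => ?_
  rw [mul_vecMulVec_star_mul, Matrix.trace, Complex.re_sum]
  refine Finset.sum_congr rfl fun c _ => ?_
  rw [Matrix.diag_apply, Matrix.vecMulVec_apply, Pi.star_apply, ← Complex.normSq_eq_norm_sq,
    Complex.star_def, Complex.mul_conj, Complex.ofReal_re]

end QuantumTable

/-! ### Quantum automata that move basis states to basis states -/

namespace QuantumTable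

variable {Γ : Type} {k : ℕ} {M : QuantumTable Γ k}

open Classical in
/-- In state `q`, scanning `σ`, the automaton enters the state `(F q σ).1` and writes `(F q σ).2`
with amplitude one. -/
def IsGivenBy (M : QuantumTable Γ k)
    (F : M.Q → (Fin k → TapeSymbol Γ) → M.Q × M.Ω) : Prop :=
  ∀ q σ p ω, M.δ q σ p ω = if (p, ω) = F q σ then 1 else 0

variable {F : M.Q → (Fin k → TapeSymbol Γ) → M.Q × M.Ω}

theorem IsGivenBy.wellFormed (hF : M.IsGivenBy F) (hinj : ∀ σ, Function.Injective fun q => F q σ)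
    (hM : M.StaysOnTape) : M.WellFormed := by
  classical
  refine wellFormed_of_local hM fun σ q q' => ?_
  simp only [hF q, hF q']
  rw [← Fintype.sum_prod_type (f := fun x : M.Q × M.Ω =>
    star (if x = F q σ then (1 : ℂ) else 0) * if x = F q' σ then 1 else 0),
    Finset.sum_eq_single (F q σ)]
  · by_cases h : q = q'
    · simp [h]
    · rw [if_neg h, if_neg (fun h' : F q σ = F q' σ => h (hinj σ h')), mul_zero]
  · intro x _ hx; simp [hx]
  · simp

variable (F) in
/-- The successor of a configuration under the transition function `F`. -/
def succConfig (w : List Γ) (c : M.Config w) : M.Config w :=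
  ((F c.1 (scan w c.2)).1, fun i => advance w (c.2 i) (M.move (F c.1 (scan w c.2)).1 i))

open Classical in
theorem IsGivenBy.E_mulVec_single (hF : M.IsGivenBy F) (hM : M.StaysOnTape) (w : List Γ)
    (ω : M.Ω) (c : M.Config w) :
    M.E w ω *ᵥ Pi.single c 1 =
      if ω = (F c.1 (scan w c.2)).2 then Pi.single (succConfig F w c) 1 else 0 := by
  rw [Matrix.mulVec_single_one]
  ext ⟨p, y⟩
  rw [Matrix.col_apply, hM.E_apply, hF]
  by_cases hω : ω = (F c.1 (scan w c.2)).2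
  · rw [if_pos hω, Pi.single_apply]
    by_cases hp : p = (F c.1 (scan w c.2)).1
    · subst hp
      simp [hω, succConfig]
    · rw [if_neg (fun h : (p, ω) = _ => hp (by rw [← h])),
        if_neg (fun h : (p, y) = succConfig F w c => hp (congrArg Prod.fst h)), ite_self]
  · rw [if_neg hω, if_neg (fun h : (p, ω) = _ => hω (by rw [← h])), ite_self, Pi.zero_apply]

variable (F) in
/-- The register symbol written at the configuration. -/
def written (w : List Γ) (c : M.Config w) : M.Ω := (F c.1 (scan w c.2)).2

open Classical in
-- The state stays a single basis vector until a halting symbol is written, and is zero from then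
-- on.
theorem IsGivenBy.acceptProbAt_eq (hF : M.IsGivenBy F) (hM : M.StaysOnTape) (w : List Γ)
    (hcont : ∃ ω, M.outcome ω = Outcome.continue) (t : ℕ) :
    M.acceptProbAt w t =
      if (∀ u < t, M.outcome (written F w ((succConfig F w)^[u] (M.init w))) = Outcome.continue) ∧
        M.outcome (written F w ((succConfig F w)^[t] (M.init w))) = Outcome.accept
      then 1 else 0 := by
  obtain ⟨ω₀, hω₀⟩ := hcont
  set C : ℕ → M.Config w := fun t => (succConfig F w)^[t] (M.init w) with hC
  set A : ℕ → Prop := fun t => ∀ u < t, M.outcome (written F w (C u)) = Outcome.continue with hA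
  have hAsucc : ∀ t, A (t + 1) ↔ A t ∧ M.outcome (written F w (C t)) = Outcome.continue :=
    fun t => Nat.forall_lt_succ_right
  set ψ : ℕ → M.Config w → ℂ := fun t => if A t then Pi.single (C t) 1 else 0 with hψ
  have key : ∀ t (ω : M.Ω), M.E w ω *ᵥ ψ t =
      if A t ∧ ω = written F w (C t) then Pi.single (C (t + 1)) 1 else 0 := by
    intro t ω
    by_cases h : A t
    · have : C (t + 1) = succConfig F w (C t) := Function.iterate_succ_apply' _ _ _
      simp only [hψ, if_pos h, h, true_and]
      rw [hF.E_mulVec_single hM, this]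
      rfl
    · simp [hψ, h]
  have hd := density_eq_vecMulVec w ψ
    -- A non-halting symbol has to be named for every time. When the symbol written is a halting
    -- one, `ω₀` serves as default: it is not written, and the next vector is zero as well.
    (fun t => if M.outcome (written F w (C t)) = Outcome.continue then written F w (C t) else ω₀)
    (by simp [hψ, hC, hA]) (fun t => by split_ifs with h <;> assumption)
    (fun t => ?_) (fun t ω hω hne => ?_) t
  · rw [acceptProbAt_of_density_eq hd]
    change _ = if A t ∧ M.outcome (written F w (C t)) = Outcome.accept then 1 else 0
    by_cases h : A t ∧ M.outcome (written F w (C t)) = Outcome.accept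
    · rw [if_pos h, Finset.sum_eq_single_of_mem (written F w (C t)) (by simp [h.2])]
      · rw [key, if_pos ⟨h.1, rfl⟩, Finset.sum_eq_single (C (t + 1))]
        · simp
        · intro c _ hc; simp [hc]
        · simp
      · intro ω _ hne
        rw [key, if_neg (fun h => hne h.2)]
        simp
    · rw [if_neg h]
      refine Finset.sum_eq_zero fun ω hω => ?_
      rw [key, if_neg]
      · simp
      · rintro ⟨h1, rfl⟩
        exact h ⟨h1, (Finset.mem_filter.1 hω).2⟩
  · rw [key]
    by_cases h : M.outcome (written F w (C t)) = Outcome.continue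
    · simp [hψ, hAsucc, h]
    · have : ω₀ ≠ written F w (C t) := by rintro rfl; exact h hω₀
      simp [hψ, hAsucc, h, this]
  · rw [key, if_neg]
    rintro ⟨-, rfl⟩
    exact hne (by rw [if_pos hω])

end QuantumTable

/-! ### Quantum simulation of deterministic automata -/

instance : Fintype Outcome :=
  ⟨{Outcome.accept, Outcome.reject, Outcome.continue}, by rintro (_ | _ | _) <;> simp⟩

namespace DetFA

variable {Γ : Type} {k : ℕ} (M : DetFA Γ k)

open Classical in
/-- The state and the head moves that follow, and whether the automaton halts now. -/
noncomputable def target (q : M.Q) (σ : Fin k → TapeSymbol Γ) :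
    (M.Q × (Fin k → Bool)) × Outcome :=
  match M.δ q σ with
  | none => ((q, fun _ => false), if q ∈ M.Qa then Outcome.accept else Outcome.reject)
  -- A move requested on the right end-marker has no effect classically, but in the quantum model it
  -- would leave the tape; it is cancelled here.
  | some pd => ((pd.1, fun i => if σ i = TapeSymbol.rightEnd then false else pd.2 i),
      Outcome.continue)

theorem target_eq_false {q : M.Q} {σ : Fin k → TapeSymbol Γ} {i : Fin k}
    (hi : σ i = TapeSymbol.rightEnd) : (M.target q σ).1.2 i = false := by
  unfold target; split <;> simp [hi]

theorem target_snd_eq_continue_iff {q : M.Q} {σ : Fin k → TapeSymbol Γ} :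
    (M.target q σ).2 = Outcome.continue ↔ M.δ q σ ≠ none := by
  unfold target; split
  · rename_i h; simp only [h]; split_ifs <;> simp
  · rename_i h; simp [h]

theorem target_snd_eq_accept_iff {q : M.Q} {σ : Fin k → TapeSymbol Γ} :
    (M.target q σ).2 = Outcome.accept ↔ M.δ q σ = none ∧ q ∈ M.Qa := by
  unfold target; split
  · rename_i h; simp only [h]; split_ifs with h <;> simp [h]
  · rename_i h; simp [h]

theorem step_eq_target (w : List Γ) (c : M.Config w) :
    M.step w c = ((M.target c.1 (scan w c.2)).1.1,
      fun i => advance w (c.2 i) ((M.target c.1 (scan w c.2)).1.2 i)) := by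
  unfold target step
  cases h : M.δ c.1 (scan w c.2) with
  | none => simp [advance_false]
  | some pd =>
    refine Prod.ext rfl (funext fun i => ?_)
    dsimp only
    split_ifs with h
    · rw [advance_of_rightEnd w h, advance_of_rightEnd w h]
    · rfl

open Classical in
/-- The quantum automaton that simulates a deterministic one by storing the previous state in the
register. -/
noncomputable def toQuantumTable : QuantumTable Γ k :=
  letI := M.fintypeQ
  { Q := M.Q × (Fin k → Bool)
    Ω := (M.Q × (Fin k → Bool)) × Outcome
    decEqQ := Classical.decEq _
    δ := fun q σ p ω =>
      if (p, ω) = ((M.target q.1 σ).1, (q, (M.target q.1 σ).2)) then 1 else 0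
    move := fun p => p.2
    q₀ := (M.q₀, fun _ => false)
    outcome := fun ω => ω.2 }

/-- The transition function of the simulating quantum automaton. -/
noncomputable def transition (q : M.toQuantumTable.Q) (σ : Fin k → TapeSymbol Γ) :
    M.toQuantumTable.Q × M.toQuantumTable.Ω :=
  ((M.target q.1 σ).1, (q, (M.target q.1 σ).2))

theorem toQuantumTable_isGivenBy : M.toQuantumTable.IsGivenBy M.transition := by
  intro q σ p ω
  simp only [toQuantumTable, transition]
  congr

theorem toQuantumTable_staysOnTape : M.toQuantumTable.StaysOnTape := by
  intro q σ p ω h i hi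
  rw [M.toQuantumTable_isGivenBy] at h
  obtain h := of_not_not fun h' => h (if_neg h')
  obtain rfl : p = (M.target q.1 σ).1 := congrArg Prod.fst h
  exact M.target_eq_false hi

theorem toQuantumTable_wellFormed : M.toQuantumTable.WellFormed :=
  M.toQuantumTable_isGivenBy.wellFormed
    (fun _ _ _ h => congrArg (fun x => x.2.1) h) M.toQuantumTable_staysOnTape

/-- Forget the last head moves. -/
def forget {w : List Γ} (c : M.toQuantumTable.Config w) : M.Config w := (c.1.1, c.2)

theorem forget_iterate (w : List Γ) (t : ℕ) :
    M.forget ((QuantumTable.succConfig M.transition w)^[t] (M.toQuantumTable.init w)) =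
      (M.step w)^[t] (M.init w) :=
  Function.Semiconj.iterate_right (f := M.forget)
    (ga := QuantumTable.succConfig M.transition w) (gb := M.step w)
    (fun c => (M.step_eq_target w (M.forget c)).symm) t (M.toQuantumTable.init w)

/-- The automaton halts at the configuration. -/
def Halts (w : List Γ) (c : M.Config w) : Prop := M.δ c.1 (scan w c.2) = none

open Classical in
theorem acceptProbAt_toQuantumTable (w : List Γ) (t : ℕ) :
    M.toQuantumTable.acceptProbAt w t =
      if (∀ u < t, ¬ M.Halts w ((M.step w)^[u] (M.init w))) ∧
        M.HaltedAccepting w ((M.step w)^[t] (M.init w)) then 1 else 0 := by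
  rw [M.toQuantumTable_isGivenBy.acceptProbAt_eq M.toQuantumTable_staysOnTape w
    ⟨((M.q₀, fun _ => false), Outcome.continue), rfl⟩]
  simp only [← M.forget_iterate]
  congr 1
  exact propext (and_congr (forall₂_congr fun u _ => M.target_snd_eq_continue_iff)
    M.target_snd_eq_accept_iff)

theorem step_of_halts {w : List Γ} {c : M.Config w} (h : M.Halts w c) : M.step w c = c := by
  unfold Halts at h
  simp [step, h]

theorem iterate_step_of_halts {w : List Γ} {c : M.Config w} (h : M.Halts w c) (t : ℕ) :
    (M.step w)^[t] c = c :=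
  Function.iterate_fixed (M.step_of_halts h) t

open Classical in
-- Acceptance is counted only at the first halting time, so the series has at most one nonzero term,
-- although the classical halted configuration persists forever.
theorem acceptProb_toQuantumTable (w : List Γ) :
    M.toQuantumTable.acceptProb w = if w ∈ M.language then 1 else 0 := by
  unfold QuantumTable.acceptProb
  split_ifs with hw
  · obtain ⟨t, ht⟩ := hw
    have hex : ∃ u, M.Halts w ((M.step w)^[u] (M.init w)) := ⟨t, ht.1⟩
    have hle : Nat.find hex ≤ t := Nat.find_min' hex ht.1
    have heq : (M.step w)^[t] (M.init w) = (M.step w)^[Nat.find hex] (M.init w) := by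
      obtain ⟨d, hd⟩ := Nat.exists_eq_add_of_le' hle
      rw [hd, Function.iterate_add_apply, M.iterate_step_of_halts (Nat.find_spec hex)]
    rw [heq] at ht
    rw [tsum_eq_single (Nat.find hex)]
    · rw [acceptProbAt_toQuantumTable, if_pos ⟨fun u hu => Nat.find_min hex hu, ht⟩]
      simp
    · intro u hu
      rw [acceptProbAt_toQuantumTable, if_neg, ENNReal.ofReal_zero]
      rintro ⟨h1, h2⟩
      rcases lt_or_gt_of_ne hu with h | h
      · exact Nat.find_min hex h h2.1
      · exact h1 _ h (Nat.find_spec hex)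
  · rw [ENNReal.tsum_eq_zero]
    intro t
    rw [acceptProbAt_toQuantumTable, if_neg (fun h => hw ⟨t, h.2⟩), ENNReal.ofReal_zero]

end DetFA

theorem detClass_subset_quantumClass (Γ : Type) (k : ℕ) {ε : ℝ} (hε : 0 < ε) :
    detClass Γ k ⊆ quantumClass Γ k ε := by
  rintro _ ⟨M, rfl⟩
  refine ⟨⟨M.toQuantumTable, M.toQuantumTable_wellFormed⟩, fun w hw => ?_, fun w hw => ?_⟩
  · rw [M.acceptProb_toQuantumTable, if_pos hw]
    exact ENNReal.ofReal_le_one.2 (by linarith)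
  · rw [M.acceptProb_toQuantumTable, if_neg hw]
    exact zero_le

/-! ### The separating language and its polynomial fingerprint -/

section Balanced

variable {Γ : Type}

/-- The sum of `g p a` over the letters `a` of `w` at the positions `p ≥ x`. -/
def suffixSum {A : Type*} [AddCommMonoid A] (g : ℕ → Γ → A) (w : List Γ) (x : ℕ) : A :=
  ∑ p ∈ Finset.Ico x w.length, (w[p]?).elim 0 (g p)

theorem suffixSum_of_lt {A : Type*} [AddCommMonoid A] (g : ℕ → Γ → A) {w : List Γ} {x : ℕ}
    (hx : x < w.length) : suffixSum g w x = g x w[x] + suffixSum g w (x + 1) := by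
  rw [suffixSum, Finset.sum_eq_sum_Ico_succ_bot hx, List.getElem?_eq_getElem hx]
  rfl

theorem suffixSum_length {A : Type*} [AddCommMonoid A] (g : ℕ → Γ → A) (w : List Γ) :
    suffixSum g w w.length = 0 := by
  simp [suffixSum]

theorem suffixSum_zero_ofFn {A : Type*} [AddCommMonoid A] (g : ℕ → Γ → A) (L : ℕ) (f : ℕ → Γ) :
    suffixSum g (List.ofFn fun p : Fin L => f p) 0 = ∑ p ∈ Finset.range L, g p (f p) := by
  rw [suffixSum, List.length_ofFn, ← Finset.range_eq_Ico]
  refine Finset.sum_congr rfl fun p hp => ?_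
  rw [Finset.mem_range] at hp
  simp [hp]

variable (α : Γ) (m : ℕ)

open Classical in
/-- The letter `α` counts as `1`, every other letter as `-1`. -/
noncomputable def sign (a : Γ) : ℤ := if a = α then 1 else -1

/-- The signed count of the letters at the positions congruent to `i` modulo `m`. -/
noncomputable def excess (w : List Γ) (i : ZMod m) : ℤ :=
  suffixSum (fun p a => if (p : ZMod m) = i then sign α a else 0) w 0

/-- The words in which, on every residue class of positions modulo `m`, the letter `α` occurs as
often as all the other letters together. -/
def balanced : Language Γ := {w | ∀ i, excess α m w i = 0}

variable {m} [NeZero m]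

/-- Exchanging the two sums turns a combination of excesses into a sum over the letters, which an
automaton that knows the position modulo `m` can accumulate while reading. -/
theorem sum_excess_mul (w : List Γ) (c : ZMod m → ℤ) :
    ∑ i, excess α m w i * c i = suffixSum (fun p a => sign α a * c (p : ZMod m)) w 0 := by
  simp only [excess, suffixSum, Finset.sum_mul]
  rw [Finset.sum_comm]
  refine Finset.sum_congr rfl fun p _ => ?_
  cases w[p]? with
  | none => simp
  | some a => simp [ite_mul]

open Polynomial in
-- A nonzero polynomial of degree at most `m` has at most `m` roots. The exponents start at 1, so
-- subtracting the constant `y` cannot cancel the nonzero coefficients; arbitrary `y` is needed for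
-- coincidences of arrival times.
theorem card_filter_sum_mul_pow_eq_le {d : ZMod m → ℤ} (hd : d ≠ 0) (N : ℕ) (y : ℤ) :
    (Finset.univ.filter fun j : Fin N => ∑ i, d i * (j : ℤ) ^ (i.val + 1) = y).card ≤ m := by
  obtain ⟨i₀, hi₀⟩ := Function.ne_iff.1 hd
  set P : ℤ[X] := ∑ i, C (d i) * X ^ (i.val + 1) - C y with hP
  have hcoeff : P.coeff (i₀.val + 1) = d i₀ := by
    simp only [hP, coeff_sub, finsetSum_coeff, coeff_C_mul, coeff_X_pow, coeff_C_succ, sub_zero]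
    rw [Finset.sum_eq_single i₀]
    · simp
    · intro i _ hi
      rw [if_neg, mul_zero]
      intro h
      exact hi (ZMod.val_injective m (by omega))
    · simp
  have hP0 : P ≠ 0 := by
    rintro h
    rw [h, coeff_zero] at hcoeff
    exact hi₀ hcoeff.symm
  have hdeg : P.natDegree ≤ m := by
    refine (natDegree_sub_le _ _).trans (max_le ?_ (by simp))
    refine natDegree_sum_le_of_forall_le _ _ fun i _ => ?_
    exact (natDegree_C_mul_X_pow_le _ _).trans (ZMod.val_lt i)
  calc _ ≤ P.roots.toFinset.card := by
        refine Finset.card_le_card_of_injOn (fun j : Fin N => (j : ℤ)) (fun j hj => ?_) ?_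
        · rw [Finset.mem_coe, Finset.mem_filter] at hj
          rw [Finset.mem_coe, Multiset.mem_toFinset, mem_roots hP0, IsRoot.def]
          simp [hP, eval_finsetSum, hj.2]
        · intro a _ b _ h
          exact Fin.ext (Int.ofNat_inj.1 h)
    _ ≤ P.roots.card := Multiset.toFinset_card_le _
    _ ≤ m := (card_roots' P).trans hdeg

end Balanced

/-! ### Scanned symbols, and acceptance from an arbitrary configuration -/

section Scan

variable {Γ : Type} {k : ℕ} {w : List Γ} {x : Fin k → Pos w} {i : Fin k}

theorem scan_of_val_eq_zero (h : (x i : ℕ) = 0) : scan w x i = TapeSymbol.leftEnd := by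
  simp only [scan, List.get_eq_getElem, h]
  rfl

theorem scan_of_val_eq_succ {p : ℕ} (hp : p < w.length) (h : (x i : ℕ) = p + 1) :
    scan w x i = TapeSymbol.letter w[p] := by
  simp only [scan, List.get_eq_getElem, h]
  exact tape_getElem_succ_of_lt w hp _

theorem scan_eq_rightEnd_iff : scan w x i = TapeSymbol.rightEnd ↔ (x i : ℕ) = w.length + 1 :=
  tape_getElem_eq_rightEnd_iff w _

end Scan

namespace DetFA

variable {Γ : Type} {k : ℕ} (M : DetFA Γ k)

/-- Started in the configuration `c`, the automaton halts in an accepting state. -/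
def AcceptsFrom (w : List Γ) (c : M.Config w) : Prop :=
  ∃ t, M.HaltedAccepting w ((M.step w)^[t] c)

variable {M}

theorem acceptsFrom_step_iff {w : List Γ} {c : M.Config w} :
    M.AcceptsFrom w (M.step w c) ↔ M.AcceptsFrom w c := by
  constructor
  · rintro ⟨t, ht⟩
    exact ⟨t + 1, ht⟩
  · rintro ⟨t, ht⟩
    rcases t with _ | t
    · refine ⟨0, ?_⟩
      rw [Function.iterate_zero_apply] at ht ⊢
      rwa [M.step_of_halts ht.1]
    · exact ⟨t, ht⟩

theorem acceptsFrom_iff_of_halts {w : List Γ} {c : M.Config w} (h : M.Halts w c) :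
    M.AcceptsFrom w c ↔ c.1 ∈ M.Qa := by
  simp only [AcceptsFrom, M.iterate_step_of_halts h]
  exact ⟨fun ⟨_, h'⟩ => h'.2, fun h' => ⟨0, h, h'⟩⟩

theorem acceptsFrom_iff_of_eq_some {w : List Γ} {q q' : M.Q} {x : Fin k → Pos w}
    {d : Fin k → Bool} (h : M.δ q (scan w x) = some (q', d)) :
    M.AcceptsFrom w (q, x) ↔ M.AcceptsFrom w (q', fun i => advance w (x i) (d i)) := by
  rw [← acceptsFrom_step_iff]
  simp [step, h]

end DetFA

/-! ### Random choice among deterministic automata -/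

section Mixture

variable {Γ : Type} {k : ℕ} {J : Type} [Fintype J] [Nonempty J] (M : J → DetFA Γ k)

/-- The probabilistic automaton that first chooses one of the automata `M j` uniformly at random,
and then simulates it. -/
noncomputable def mixture : ProbFA Γ k :=
  letI := fun j => (M j).fintypeQ
  { Q := Option (Σ j, (M j).Q)
    δ := fun q σ => match q with
      | none => some ((PMF.uniformOfFintype J).map fun j => (some ⟨j, (M j).q₀⟩, fun _ => false))
      | some ⟨j, q⟩ => ((M j).δ q σ).map fun pd => PMF.pure (some ⟨j, pd.1⟩, pd.2)
    q₀ := none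
    Qa := {x | ∃ j, ∃ q ∈ (M j).Qa, x = some ⟨j, q⟩} }

/-- A configuration of `M j` as a configuration of the mixture. -/
def mixtureConfig (w : List Γ) (j : J) (c : (M j).Config w) : (mixture M).Config w :=
  (some ⟨j, c.1⟩, c.2)

theorem mixture_step (w : List Γ) (j : J) (c : (M j).Config w) :
    (mixture M).step w (mixtureConfig M w j c) =
      PMF.pure (mixtureConfig M w j ((M j).step w c)) := by
  have h : (mixture M).δ (mixtureConfig M w j c).1 (scan w (mixtureConfig M w j c).2) =
    ((M j).δ c.1 (scan w c.2)).map fun pd => PMF.pure (some ⟨j, pd.1⟩, pd.2) := rfl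
  unfold ProbFA.step DetFA.step
  rw [h]
  cases (M j).δ c.1 (scan w c.2) with
  | none => rfl
  | some pd => exact PMF.pure_map _ _

theorem mixture_haltedAccepting (w : List Γ) (j : J) (c : (M j).Config w) :
    (mixture M).HaltedAccepting w (mixtureConfig M w j c) ↔ (M j).HaltedAccepting w c := by
  refine and_congr Option.map_eq_none_iff ⟨?_, fun h => ⟨j, c.1, h, rfl⟩⟩
  rintro ⟨j', q, hq, h⟩
  cases h
  exact hq

/-- The first step is spent on the draw and moves no head, so the mixture lags one step behind the
chosen automaton. -/
theorem mixture_run_succ (w : List Γ) (t : ℕ) :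
    (mixture M).run w (t + 1) = (PMF.uniformOfFintype J).map fun j =>
      mixtureConfig M w j (((M j).step w)^[t] ((M j).init w)) := by
  induction t with
  | zero =>
    rw [ProbFA.run, ProbFA.run, PMF.pure_bind]
    change PMF.map _ (PMF.map _ _) = _
    refine (PMF.map_comp _ _ _).trans (congrArg (fun f => PMF.map f _) (funext fun j => ?_))
    exact Prod.ext rfl (funext fun i => advance_false w _)
  | succ t ih =>
    rw [ProbFA.run, ih, PMF.bind_map]
    simp only [Function.comp_def, mixture_step, Function.iterate_succ_apply']
    rfl

open Classical in
theorem mixture_run_succ_toOuterMeasure (w : List Γ) (t : ℕ) :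
    ((mixture M).run w (t + 1)).toOuterMeasure {c | (mixture M).HaltedAccepting w c} =
      (Finset.univ.filter fun j =>
        (M j).HaltedAccepting w (((M j).step w)^[t] ((M j).init w))).card / Fintype.card J := by
  rw [mixture_run_succ, PMF.toOuterMeasure_map_apply, PMF.toOuterMeasure_uniformOfFintype_apply,
    Fintype.card_subtype]
  simp only [Set.mem_preimage, Set.mem_ofPred_eq, mixture_haltedAccepting]

open Classical in
theorem mixture_acceptProb (w : List Γ) :
    (mixture M).acceptProb w =
      (Finset.univ.filter fun j => w ∈ (M j).language).card / Fintype.card J := by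
  apply le_antisymm
  · refine iSup_le fun t => ?_
    rcases t with _ | t
    · rw [ProbFA.run, PMF.toOuterMeasure_pure_apply, if_neg]
      · exact zero_le
      · rintro ⟨h, -⟩
        cases h
    · rw [mixture_run_succ_toOuterMeasure]
      gcongr
      exact fun j => ⟨t, ‹_›⟩
  · have : ∀ j, ∃ t, w ∈ (M j).language →
        (M j).HaltedAccepting w (((M j).step w)^[t] ((M j).init w)) := by
      intro j
      by_cases h : w ∈ (M j).language
      · obtain ⟨t, ht⟩ := h
        exact ⟨t, fun _ => ht⟩
      · exact ⟨0, fun h' => absurd h' h⟩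
    choose T hT using this
    -- There are finitely many automata, so at one common time all those that accept have halted;
    -- halted configurations persist.
    refine le_trans ?_ (le_iSup _ (Finset.univ.sup T + 1))
    rw [mixture_run_succ_toOuterMeasure]
    gcongr with j
    intro h
    have hj := hT j h
    obtain ⟨d, hd⟩ := Nat.exists_eq_add_of_le' (Finset.le_sup (f := T) (Finset.mem_univ j))
    rw [hd, Function.iterate_add_apply, (M j).iterate_step_of_halts hj.1]
    exact hj

end Mixture

theorem detClass_subset_probClass (Γ : Type) (k : ℕ) {ε : ℝ} (hε : 0 < ε) :
    detClass Γ k ⊆ probClass Γ k ε := by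
  classical
  rintro _ ⟨M, rfl⟩
  refine ⟨mixture fun _ : Unit => M, fun w hw => ?_, fun w hw => ?_⟩
  · rw [mixture_acceptProb]
    simp only [hw, Finset.filter_true, Finset.card_univ, Fintype.card_unit, Nat.cast_one, div_one]
    exact ENNReal.ofReal_le_one.2 (by linarith)
  · rw [mixture_acceptProb]
    simp [hw]

/-! ### A deterministic three-head test for a weighted letter sum -/

section LinearTest

variable {Γ : Type} {k m D : ℕ} [NeZero m] [NeZero D] (g : ZMod m → Γ → ℤ)

open Classical in
/-- The automaton that tests whether the weights `g p a` of the letters add up to zero. Head `0`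
reads the input; the current sum is `D` times the distance from head `2` to head `1` plus the number
in the state. -/
noncomputable def linearTest (k D : ℕ) [NeZero D] : DetFA Γ (k + 3) where
  Q := Option (ZMod m × Fin D)
  δ := fun q σ => match q with
    | none => none
    | some (r, c) => match σ 0 with
      | TapeSymbol.leftEnd => some (some (r, c), fun i => decide (i = 0))
      | TapeSymbol.letter a => some (some (r + 1, Fin.ofNat D (((c : ℤ) + g r a) % D).toNat),
          fun i => decide (i = 0 ∨ (i = 1 ∧ D ≤ (c : ℤ) + g r a) ∨ (i = 2 ∧ (c : ℤ) + g r a < 0)))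
      | TapeSymbol.rightEnd =>
        if (c : ℕ) = 0 then
          if σ 1 = TapeSymbol.rightEnd ∧ σ 2 = TapeSymbol.rightEnd then some (none, fun _ => false)
          else if σ 1 = TapeSymbol.rightEnd ∨ σ 2 = TapeSymbol.rightEnd then none
          else some (some (r, c), fun i => decide (i = 1 ∨ i = 2))
        else none
  q₀ := some (0, 0)
  Qa := {none}

theorem val_two_fin : ((2 : Fin (k + 3)) : ℕ) = 2 := Fin.val_two

theorem zero_ne_two_fin : (0 : Fin (k + 3)) ≠ 2 := fun h => by
  have := congrArg Fin.val h
  rw [val_two_fin] at this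
  simp at this

theorem one_ne_two_fin : (1 : Fin (k + 3)) ≠ 2 := fun h => by
  have := congrArg Fin.val h
  rw [val_two_fin] at this
  simp at this

/-- With remainder zero, heads `1` and `2` march in lockstep, so they reach the right end-marker
together exactly if they start on the same square. The induction is on the distance of head `1` from
the end. -/
theorem linearTest_acceptsFrom_of_rightEnd (w : List Γ) (r : ZMod m) (c : Fin D)
    (x : Fin (k + 3) → Pos w) (h0 : (x 0 : ℕ) = w.length + 1) :
    (linearTest g k D).AcceptsFrom w (some (r, c), x) ↔ (c : ℕ) = 0 ∧ (x 1 : ℕ) = x 2 := by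
  obtain ⟨d, hd⟩ : ∃ d, d = w.length + 1 - (x 1 : ℕ) := ⟨_, rfl⟩
  induction d generalizing x with
  | zero =>
    have hx1 := val_lt_length_add_two w (x 1)
    have hs0 : scan w x 0 = TapeSymbol.rightEnd := scan_eq_rightEnd_iff.2 h0
    have hs1 : scan w x 1 = TapeSymbol.rightEnd := scan_eq_rightEnd_iff.2 (by omega)
    by_cases hc : (c : ℕ) = 0 ∧ scan w x 2 = TapeSymbol.rightEnd
    · have hx2 := scan_eq_rightEnd_iff.1 hc.2
      refine (DetFA.acceptsFrom_iff_of_eq_some (M := linearTest g k D) (q' := none)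
        (d := fun _ => false) (by simp [linearTest, hs0, hs1, hc])).trans
        ((DetFA.acceptsFrom_iff_of_halts ?_).trans (iff_of_true ?_ ⟨hc.1, by omega⟩))
      · simp [DetFA.Halts, linearTest]
      · exact Set.mem_singleton _
    · rw [DetFA.acceptsFrom_iff_of_halts]
      · refine iff_of_false (fun h => by cases h) fun h => hc ⟨h.1, scan_eq_rightEnd_iff.2 ?_⟩
        omega
      · rw [not_and] at hc
        by_cases h : (c : ℕ) = 0
        · simp only [DetFA.Halts, linearTest, hs0, hs1, hc h]
          simp
        · simp [DetFA.Halts, linearTest, hs0, h]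
  | succ d ih =>
    have hx1 := val_lt_length_add_two w (x 1)
    have hx2 := val_lt_length_add_two w (x 2)
    have hs0 : scan w x 0 = TapeSymbol.rightEnd := scan_eq_rightEnd_iff.2 h0
    have hs1 : scan w x 1 ≠ TapeSymbol.rightEnd := fun h => by
      have := scan_eq_rightEnd_iff.1 h
      omega
    by_cases hc : (c : ℕ) = 0 ∧ scan w x 2 ≠ TapeSymbol.rightEnd
    · have hne := mt scan_eq_rightEnd_iff.2 hc.2
      have e0 : (advance w (x 0) (decide ((0 : Fin (k + 3)) = 1 ∨ (0 : Fin (k + 3)) = 2)) : ℕ)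
          = w.length + 1 := by
        rw [val_advance, if_neg (by omega), h0]
      have e1 : (advance w (x 1) (decide ((1 : Fin (k + 3)) = 1 ∨ (1 : Fin (k + 3)) = 2)) : ℕ)
          = x 1 + 1 := by
        rw [val_advance, if_pos ⟨by simp, by omega⟩]
      have e2 : (advance w (x 2) (decide ((2 : Fin (k + 3)) = 1 ∨ (2 : Fin (k + 3)) = 2)) : ℕ)
          = x 2 + 1 := by
        rw [val_advance, if_pos ⟨by simp, by omega⟩]
      refine (DetFA.acceptsFrom_iff_of_eq_some (M := linearTest g k D) (q' := some (r, c))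
        (d := fun i => decide (i = 1 ∨ i = 2)) (by simp [linearTest, hs0, hs1, hc])).trans
        ((ih (fun i => advance w (x i) (decide (i = 1 ∨ i = 2))) e0 (by rw [e1]; omega)).trans ?_)
      rw [e1, e2]
      omega
    · rw [DetFA.acceptsFrom_iff_of_halts]
      · refine iff_of_false (fun h => by cases h) fun h => hc ⟨h.1, fun h2 => ?_⟩
        have := scan_eq_rightEnd_iff.1 h2
        omega
      · rw [not_and, not_not] at hc
        by_cases h : (c : ℕ) = 0
        · simp only [DetFA.Halts, linearTest, hs0, hs1, hc h]
          simp
        · simp [DetFA.Halts, linearTest, hs0, h]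

/-- The invariant is that the sum so far equals `D` times the head distance plus the remainder `c`.
As weights are at most `D` in absolute value, adding one to `c` needs at most one carry (head `1`)
or one borrow (head `2`). Each of these heads moves at most once per letter, hence stays behind head
`0` and is not stopped by the end-marker. -/
theorem linearTest_acceptsFrom (hg : ∀ r a, |g r a| ≤ D) (w : List Γ) (p : ℕ)
    (hp : p ≤ w.length) (c : Fin D) (x : Fin (k + 3) → Pos w) (h0 : (x 0 : ℕ) = p + 1)
    (h1 : (x 1 : ℕ) ≤ p) (h2 : (x 2 : ℕ) ≤ p) :
    (linearTest g k D).AcceptsFrom w (some ((p : ZMod m), c), x) ↔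
      D * ((x 1 : ℤ) - x 2) + c + suffixSum (fun p a => g (p : ZMod m) a) w p = 0 := by
  have hD : 0 < D := NeZero.pos D
  have hc := c.2
  induction hp using Nat.decreasingInduction generalizing c x with
  | self =>
    rw [linearTest_acceptsFrom_of_rightEnd g w _ c x h0, suffixSum_length, add_zero]
    constructor
    · rintro ⟨h, h'⟩
      simp [h, h']
    · intro h
      -- Since 0 ≤ c < D, a vanishing `D * (x 1 - x 2) + c` forces both summands to vanish.
      have h3 : (x 1 : ℤ) - x 2 = 0 := by
        by_contra hne
        rcases lt_or_gt_of_ne hne with hlt | hlt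
        · have : (D : ℤ) * ((x 1 : ℤ) - x 2) ≤ D * (-1) :=
            mul_le_mul_of_nonneg_left (by omega) (by omega)
          omega
        · have : (D : ℤ) * 1 ≤ D * ((x 1 : ℤ) - x 2) :=
            mul_le_mul_of_nonneg_left (by omega) (by omega)
          omega
      rw [h3] at h
      omega
  | of_succ p hp ih =>
    have hs0 := scan_of_val_eq_succ hp h0
    have hga := abs_le.1 (hg (p : ZMod m) w[p])
    set y : ℤ := (c : ℤ) + g (p : ZMod m) w[p] with hy
    refine (DetFA.acceptsFrom_iff_of_eq_some (M := linearTest g k D)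
      (q' := some ((p : ZMod m) + 1, Fin.ofNat D (y % D).toNat))
      (d := fun i => decide (i = 0 ∨ (i = 1 ∧ D ≤ y) ∨ (i = 2 ∧ y < 0)))
      (by simp [linearTest, hs0, hy])).trans ?_
    have hmod0 := Int.emod_nonneg y (b := D) (by omega)
    have hmod1 := Int.emod_lt_of_pos y (b := D) (by omega)
    have ec : ((Fin.ofNat D (y % D).toNat : Fin D) : ℕ) = (y % D).toNat :=
      Nat.mod_eq_of_lt (by omega)
    have e0 : (advance w (x 0) (decide ((0 : Fin (k + 3)) = 0 ∨ ((0 : Fin (k + 3)) = 1 ∧ D ≤ y) ∨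
        ((0 : Fin (k + 3)) = 2 ∧ y < 0))) : ℕ) = p + 1 + 1 := by
      rw [val_advance, if_pos ⟨by simp, by omega⟩, h0]
    have e1 : (advance w (x 1) (decide ((1 : Fin (k + 3)) = 0 ∨ ((1 : Fin (k + 3)) = 1 ∧ D ≤ y) ∨
        ((1 : Fin (k + 3)) = 2 ∧ y < 0))) : ℕ) = if D ≤ y then (x 1 : ℕ) + 1 else x 1 := by
      rw [val_advance]
      have : (x 1 : ℕ) < w.length + 1 := by omega
      simp [one_ne_two_fin, this]
    have e2 : (advance w (x 2) (decide ((2 : Fin (k + 3)) = 0 ∨ ((2 : Fin (k + 3)) = 1 ∧ D ≤ y) ∨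
        ((2 : Fin (k + 3)) = 2 ∧ y < 0))) : ℕ) = if y < 0 then (x 2 : ℕ) + 1 else x 2 := by
      rw [val_advance]
      have : (x 2 : ℕ) < w.length + 1 := by omega
      simp [one_ne_two_fin.symm, zero_ne_two_fin.symm, this]
    have hcast : (p : ZMod m) + 1 = ((p + 1 : ℕ) : ZMod m) := by push_cast; rfl
    rw [hcast]
    refine (ih _ (fun i => advance w (x i)
      (decide (i = 0 ∨ (i = 1 ∧ D ≤ y) ∨ (i = 2 ∧ y < 0)))) e0
      (by rw [e1]; split_ifs <;> omega) (by rw [e2]; split_ifs <;> omega) (Fin.is_lt _)).trans ?_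
    rw [e1, e2, ec, Int.toNat_of_nonneg hmod0, suffixSum_of_lt _ hp]
    have hy' : g (p : ZMod m) w[p] = y - c := by rw [hy]; ring
    rw [hy']
    rcases lt_or_ge y 0 with hneg | hnn
    · have hm : y % D = y + D := by
        rw [← Int.add_emod_right, Int.emod_eq_of_lt (by omega) (by omega)]
      rw [if_pos hneg, if_neg (by omega), hm]
      push_cast
      constructor <;> intro h <;> linarith
    · rcases lt_or_ge y D with hlt | hge
      · rw [if_neg (by omega), if_neg (by omega), Int.emod_eq_of_lt hnn hlt]
        constructor <;> intro h <;> linarith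
      · have hm : y % D = y - D := by
          rw [← Int.sub_emod_right, Int.emod_eq_of_lt (by omega) (by omega)]
        rw [if_pos hge, if_neg (by omega), hm]
        push_cast
        constructor <;> intro h <;> linarith

theorem mem_language_linearTest_iff (hg : ∀ r a, |g r a| ≤ D) (w : List Γ) :
    w ∈ (linearTest g k D).language ↔ suffixSum (fun p a => g (p : ZMod m) a) w 0 = 0 := by
  have hs0 : scan w (fun _ : Fin (k + 3) => startPos w) 0 = TapeSymbol.leftEnd :=
    scan_of_val_eq_zero rfl
  have hval : ((startPos w : Pos w) : ℕ) = 0 := rfl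
  refine (DetFA.acceptsFrom_iff_of_eq_some (M := linearTest g k D)
    (q' := some ((0 : ZMod m), (0 : Fin D))) (d := fun i => decide (i = 0))
    (by simp [linearTest, hs0])).trans ?_
  have e0 : (advance w (startPos w) (decide ((0 : Fin (k + 3)) = 0)) : ℕ) = 0 + 1 := by
    simp [val_advance, hval]
  have e1 : (advance w (startPos w) (decide ((1 : Fin (k + 3)) = 0)) : ℕ) = 0 := by
    simp [val_advance, hval]
  have e2 : (advance w (startPos w) (decide ((2 : Fin (k + 3)) = 0)) : ℕ) = 0 := by
    simp [val_advance, hval, zero_ne_two_fin.symm]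
  have h := linearTest_acceptsFrom g hg w 0 (Nat.zero_le _) (0 : Fin D)
    (fun i : Fin (k + 3) => advance w (startPos w) (decide (i = 0))) e0 e1.le e2.le
  rw [Nat.cast_zero] at h
  refine h.trans ?_
  rw [e1, e2]
  simp

end LinearTest

/-! ### Probabilistic recognition of balanced words -/

theorem notMem_balanced_iff {Γ : Type} (α : Γ) {m : ℕ} [NeZero m] {w : List Γ} :
    w ∉ balanced α m ↔ excess α m w ≠ 0 := by
  rw [Ne, funext_iff]
  rfl

theorem balanced_mem_probClass {Γ : Type} (α : Γ) (m : ℕ) [NeZero m] (k : ℕ) {ε : ℝ} (hε : 0 < ε) :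
    balanced α m ∈ probClass Γ (k + 3) ε := by
  classical
  -- At most `m` of the `N` equally likely points are roots, so an unbalanced word is accepted with
  -- probability at most m/N < ε.
  obtain ⟨N, hN⟩ := exists_nat_gt (m / ε)
  have hN0 : (0 : ℝ) < N := lt_of_le_of_lt (by positivity) hN
  have hNpos : 0 < N := by exact_mod_cast hN0
  have : NeZero N := ⟨hNpos.ne'⟩
  set g : Fin N → ZMod m → Γ → ℤ := fun j r a => sign α a * (j : ℤ) ^ (r.val + 1) with hg
  have hbound : ∀ j r a, |g j r a| ≤ ((N ^ m : ℕ) : ℤ) := by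
    intro j r a
    have h1 : |sign α a| = 1 := by unfold sign; split_ifs <;> simp
    rw [hg, abs_mul, h1, one_mul, abs_of_nonneg (by positivity)]
    have h2 : (j : ℕ) ^ (r.val + 1) ≤ N ^ m :=
      (Nat.pow_le_pow_left j.2.le _).trans (Nat.pow_le_pow_right hNpos (ZMod.val_lt r))
    exact_mod_cast h2
  have hlang : ∀ w j, w ∈ (linearTest (g j) k (N ^ m)).language ↔
      ∑ i, excess α m w i * (j : ℤ) ^ (i.val + 1) = 0 := by
    intro w j
    rw [mem_language_linearTest_iff (g j) (hbound j), sum_excess_mul]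
  refine ⟨mixture fun j : Fin N => linearTest (g j) k (N ^ m), fun w hw => ?_, fun w hw => ?_⟩
  · rw [mixture_acceptProb, Finset.filter_true_of_mem, Finset.card_univ, ENNReal.div_self]
    · exact ENNReal.ofReal_le_one.2 (by linarith)
    · simp [hNpos.ne']
    · simp
    · intro j _
      rw [hlang]
      exact Finset.sum_eq_zero fun i _ => by rw [hw i, zero_mul]
  · rw [mixture_acceptProb]
    simp only [hlang]
    have hcard := card_filter_sum_mul_pow_eq_le ((notMem_balanced_iff α).1 hw) N 0
    calc _ ≤ (m : ℝ≥0∞) / N := by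
          rw [Fintype.card_fin]
          gcongr
      _ = ENNReal.ofReal (m / N) := by
          rw [ENNReal.ofReal_div_of_pos hN0, ENNReal.ofReal_natCast, ENNReal.ofReal_natCast]
      _ ≤ ENNReal.ofReal ε := by
          refine ENNReal.ofReal_le_ofReal ?_
          rw [div_le_iff₀ hN0]
          rw [div_lt_iff₀ hε] at hN
          linarith

/-! ### Quantum recognition with one head: a race of runners in superposition -/

theorem QuantumTable.StaysOnTape.E_mulVec_single {Γ : Type} {k : ℕ} {M : QuantumTable Γ k}
    (hM : M.StaysOnTape) (w : List Γ) (ω : M.Ω) (c : M.Config w) :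
    M.E w ω *ᵥ Pi.single c 1 = ∑ p, M.δ c.1 (scan w c.2) p ω •
      Pi.single (p, fun i => advance w (c.2 i) (M.move p i)) 1 := by
  rw [Matrix.mulVec_single_one]
  ext ⟨p, y⟩
  rw [Matrix.col_apply, hM.E_apply, Finset.sum_apply, Finset.sum_eq_single p]
  · simp [Pi.single_apply]
  · intro p' _ hp'
    simp [hp'.symm]
  · simp

section Race

variable {Γ : Type} (J : Type) (m D : ℕ)

/-- The states of the race automaton: a runner `j`, the residue of its position, and the number of
steps that it has spent on the current square. -/
abbrev RaceState : Type := Option (J × ZMod m × Fin (D + 1))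

/-- The register symbols of the race automaton: `none` is the non-halting one, the left summand
consists of the accepting ones, and the right summand of the rejecting ones. -/
abbrev RaceSymbol : Type := Option ((ZMod m × Fin (D + 1)) ⊕ RaceState J m D)

variable {J m D} (delay : J → ZMod m → Γ → ℕ)

/-- On the letter `a`, the runner `j` waits `delay j r a` steps and then moves. -/
def raceMove (a : Γ) : RaceState J m D → RaceState J m D × RaceSymbol J m D
  | none => (none, some (Sum.inr none))
  | some (j, r, c) =>
    if h : (c : ℕ) < delay j r a ∧ (c : ℕ) < D then
      (some (j, r, ⟨c + 1, Nat.succ_lt_succ h.2⟩), none)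
    else if (c : ℕ) = delay j r a then (some (j, r + 1, 0), none)
    else (none, some (Sum.inr (some (j, r, c))))

/-- A wait leaves a positive counter and a move leaves counter zero, so the entered state reveals
which occurred, and after a move the old counter is the delay. Counters that fit neither case are
rejected with the whole old state on the register. Thus running needs no record that would spoil the
interference. -/
theorem raceMove_injective (a : Γ) :
    Function.Injective (raceMove delay a : RaceState J m D → _) := by
  rintro (_ | ⟨j, r, c⟩) (_ | ⟨j', r', c'⟩) h
  · rfl
  · simp only [raceMove] at h
    split_ifs at h <;> simp at h
  · simp only [raceMove] at h
    split_ifs at h <;> simp at h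
  · simp only [raceMove] at h
    split_ifs at h <;>
      simp only [Prod.mk.injEq, Option.some.injEq, Sum.inr.injEq, reduceCtorEq,
        and_true, and_false, Fin.ext_iff, Fin.val_zero,
        Nat.succ_ne_zero, Nat.zero_ne_add_one, add_left_inj] at h ⊢
    · exact h
    · obtain ⟨rfl, rfl, -⟩ := h
      exact ⟨rfl, rfl, by omega⟩
    · exact h.2

/-- The amplitude of a single runner in the uniform superposition. -/
noncomputable def raceAmp (J : Type) [Fintype J] : ℂ := (((√(Fintype.card J : ℝ))⁻¹ : ℝ) : ℂ)

theorem star_raceAmp (J : Type) [Fintype J] : star (raceAmp J) = raceAmp J := Complex.conj_ofReal _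

theorem raceAmp_mul_self (J : Type) [Fintype J] :
    raceAmp J * raceAmp J = (Fintype.card J : ℂ)⁻¹ := by
  rw [raceAmp, ← Complex.ofReal_mul, ← mul_inv, Real.mul_self_sqrt (Nat.cast_nonneg _)]
  push_cast
  rfl

variable [Fintype J] [DecidableEq J]

instance decidableEqRace : DecidableEq (RaceState J m D × RaceSymbol J m D) :=
  instDecidableEqProd

variable [NeZero m]

/-- The vector of the amplitudes of the transitions. -/
noncomputable def raceVector : RaceState J m D → TapeSymbol Γ →
    RaceState J m D × RaceSymbol J m D → ℂ
  | none, TapeSymbol.leftEnd => raceAmp J • ∑ j, Pi.single (some (j, 0, 0), none) 1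
  | some x, TapeSymbol.leftEnd => Pi.single (none, some (Sum.inr (some x))) 1
  | q, TapeSymbol.letter a => Pi.single (raceMove delay a q) 1
  | none, TapeSymbol.rightEnd => Pi.single (none, some (Sum.inr none)) 1
  | some (j, r, c), TapeSymbol.rightEnd =>
    raceAmp J • Pi.single (none, some (Sum.inl (r, c))) 1 +
      (Pi.single (none, some (Sum.inr (some (j, r, c)))) 1 -
        (raceAmp J * raceAmp J) • ∑ l, Pi.single (none, some (Sum.inr (some (l, r, c)))) 1)

/-- The automaton that runs with all the runners in superposition, and accepts those that arrive at
the right end-marker at the same time if they are in the uniform superposition. -/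
@[reducible]
noncomputable def raceTable (k : ℕ) : QuantumTable Γ (k + 1) where
  Q := RaceState J m D
  Ω := RaceSymbol J m D
  δ := fun q σ p ω => raceVector delay q (σ 0) (p, ω)
  move := fun p i => match p with
    | none => false
    | some (_, _, c) => decide (i = 0 ∧ c = 0)
  q₀ := none
  outcome := fun ω => match ω with
    | none => Outcome.continue
    | some (Sum.inl _) => Outcome.accept
    | some (Sum.inr _) => Outcome.reject

/-- At the right end-marker the runner `j` is split into its component along the uniform
superposition, of amplitude 1/√N, and the orthogonal remainder. For equal `r` and `c` the inner
products of these parts are 1/N and δ - 1/N, with δ the Kronecker symbol of the two runners. -/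
theorem raceVector_orthonormal [Nonempty J] (σ : TapeSymbol Γ) (q q' : RaceState J m D) :
    star (raceVector delay q σ) ⬝ᵥ raceVector delay q' σ = if q = q' then 1 else 0 := by
  have hN : (Fintype.card J : ℂ) ≠ 0 := by simp
  rcases σ with _ | a | _
  · rcases q with _ | x <;> rcases q' with _ | x' <;>
      simp [raceVector, Pi.single_apply, star_raceAmp, ← mul_assoc, dotProduct_sum, eq_comm]
    rw [mul_right_comm, raceAmp_mul_self, inv_mul_cancel₀ hN]
  · simp [raceVector, Pi.single_apply, (raceMove_injective delay a).eq_iff, eq_comm]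
  · rcases q with _ | ⟨j, r, c⟩ <;> rcases q' with _ | ⟨j', r', c'⟩ <;>
      simp [raceVector, Pi.single_apply, star_raceAmp, raceAmp_mul_self, dotProduct_sum]
    by_cases hrc : r' = r ∧ c' = c
    · obtain ⟨rfl, rfl⟩ := hrc
      by_cases hj : j' = j
      · subst hj
        simp [Finset.filter_eq, Finset.filter_eq', hN]
      · simp [Finset.filter_eq, Finset.filter_eq', hN, hj, Ne.symm hj]
    · have hrc' : ¬(r = r' ∧ c = c') := fun h => hrc ⟨h.1.symm, h.2.symm⟩
      simp [hrc, hrc']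

theorem raceTable_staysOnTape (k : ℕ) :
    QuantumTable.StaysOnTape (raceTable (D := D) delay k) := by
  rintro q σ (_ | ⟨j, r, c⟩) ω h i hi
  · rfl
  · by_contra hmove
    simp only [Bool.not_eq_false, decide_eq_true_eq] at hmove
    obtain ⟨rfl, rfl⟩ := hmove
    apply h
    simp only [hi]
    rcases q with _ | ⟨j', r', c'⟩ <;> simp [raceVector]

theorem raceTable_wellFormed [Nonempty J] (k : ℕ) :
    QuantumTable.WellFormed (raceTable (D := D) delay k) := by
  refine QuantumTable.wellFormed_of_local (raceTable_staysOnTape delay k) fun σ q q' => ?_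
  rw [← raceVector_orthonormal delay (σ 0) q q', dotProduct, Fintype.sum_prod_type]
  rfl

/-- Head `0` on the square `p`, the other heads on the left end-marker. -/
def headsAt (k : ℕ) (w : List Γ) (p : ℕ) : Fin (k + 1) → Pos w := fun i =>
  if i = 0 then ⟨min p (w.length + 1), by rw [length_tape]; omega⟩ else startPos w

theorem val_headsAt_zero {k : ℕ} {w : List Γ} {p : ℕ} (hp : p ≤ w.length + 1) :
    (headsAt k w p 0 : ℕ) = p := by
  simp [headsAt, hp]

theorem headsAt_zero (k : ℕ) (w : List Γ) : headsAt k w 0 = fun _ => startPos w := by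
  funext i
  unfold headsAt
  split_ifs
  · exact Fin.ext (by simp [startPos])
  · rfl

theorem advance_headsAt (k : ℕ) {w : List Γ} {p : ℕ} (hp : p ≤ w.length) (c : Fin (D + 1)) :
    (fun i => advance w (headsAt k w p i) (decide (i = 0 ∧ c = 0))) =
      if c = 0 then headsAt k w (p + 1) else headsAt k w p := by
  funext i
  by_cases hc : c = 0
  · by_cases hi : i = 0
    · subst hi
      refine Fin.ext ?_
      rw [val_advance, val_headsAt_zero (by omega), if_pos ⟨by simp [hc], by omega⟩, if_pos hc,
        val_headsAt_zero (by omega)]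
    · simp [hc, hi, advance_false, headsAt]
  · simp [hc, advance_false]

variable (k : ℕ) (w : List Γ)

/-- The configuration in which the runner `j` has read `p` letters and has spent `c` steps on the
current square. -/
def runnerConfig (j : J) (p : ℕ) (c : Fin (D + 1)) :
    (raceTable (m := m) (D := D) delay k).Config w :=
  (some (j, (p : ZMod m), c), headsAt k w (p + 1))

/-- The configuration that is entered at the right end-marker. -/
def finishConfig : (raceTable (m := m) (D := D) delay k).Config w :=
  (none, headsAt k w (w.length + 1))

theorem race_E_runnerConfig_of_lt (ω : RaceSymbol J m D) (j : J) {p : ℕ} (hp : p < w.length)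
    (c : Fin (D + 1)) :
    (raceTable delay k).E w ω *ᵥ Pi.single (runnerConfig delay k w j p c) 1 =
      if ω = (raceMove delay w[p] (some (j, (p : ZMod m), c))).2 then
        Pi.single ((raceMove delay w[p] (some (j, (p : ZMod m), c))).1,
          fun i => advance w (headsAt k w (p + 1) i)
            ((raceTable delay k).move (raceMove delay w[p] (some (j, (p : ZMod m), c))).1 i)) 1
      else 0 := by
  have hs : scan w (headsAt k w (p + 1)) 0 = TapeSymbol.letter w[p] :=
    scan_of_val_eq_succ hp (val_headsAt_zero (by omega))
  rw [(raceTable_staysOnTape delay k).E_mulVec_single]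
  simp only [runnerConfig, hs, raceVector]
  rw [Finset.sum_eq_single (raceMove delay w[p] (some (j, (p : ZMod m), c))).1]
  · by_cases h : ω = (raceMove delay w[p] (some (j, (p : ZMod m), c))).2
    · simp [h]
    · rw [if_neg h, Pi.single_eq_of_ne, zero_smul]
      exact fun h' => h (congrArg Prod.snd h')
  · intro q _ hq
    rw [Pi.single_eq_of_ne, zero_smul]
    exact fun h' => hq (congrArg Prod.fst h')
  · intro h
    exact absurd (Finset.mem_univ _) h

theorem race_E_none_runnerConfig_of_lt_delay (j : J) {p : ℕ} (hp : p < w.length) (c : Fin (D + 1))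
    (hc : (c : ℕ) < delay j (p : ZMod m) w[p]) (hcD : (c : ℕ) < D) :
    (raceTable delay k).E w none *ᵥ Pi.single (runnerConfig delay k w j p c) 1 =
      Pi.single (runnerConfig delay k w j p ⟨c + 1, Nat.succ_lt_succ hcD⟩) 1 := by
  have h : raceMove delay w[p] (some (j, (p : ZMod m), c)) =
    (some (j, (p : ZMod m), ⟨c + 1, Nat.succ_lt_succ hcD⟩), none) := dif_pos ⟨hc, hcD⟩
  rw [race_E_runnerConfig_of_lt _ _ _ _ _ hp, h, if_pos rfl]
  have hne : (⟨c + 1, Nat.succ_lt_succ hcD⟩ : Fin (D + 1)) ≠ 0 := fun h =>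
    Nat.succ_ne_zero _ (congrArg Fin.val h)
  have := advance_headsAt k (w := w) (p := p + 1) hp ⟨c + 1, Nat.succ_lt_succ hcD⟩
  rw [if_neg hne] at this
  exact congrArg (fun c => (Pi.single c (1 : ℂ) : (raceTable delay k).Config w → ℂ))
    (Prod.ext rfl this)

theorem race_E_none_runnerConfig_of_eq_delay (j : J) {p : ℕ} (hp : p < w.length) (c : Fin (D + 1))
    (hc : (c : ℕ) = delay j (p : ZMod m) w[p]) :
    (raceTable delay k).E w none *ᵥ Pi.single (runnerConfig delay k w j p c) 1 =
      Pi.single (runnerConfig delay k w j (p + 1) 0) 1 := by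
  have h : raceMove delay w[p] (some (j, (p : ZMod m), c)) =
    (some (j, (p : ZMod m) + 1, 0), none) := by
    simp [raceMove, hc]
  rw [race_E_runnerConfig_of_lt _ _ _ _ _ hp, h, if_pos rfl]
  have := advance_headsAt (D := D) k (w := w) (p := p + 1) hp 0
  rw [if_pos rfl] at this
  rw [runnerConfig, Nat.cast_add, Nat.cast_one]
  exact congrArg (fun c => (Pi.single c (1 : ℂ) : (raceTable delay k).Config w → ℂ))
    (Prod.ext rfl this)

theorem race_E_inl_runnerConfig_of_lt (j : J) {p : ℕ} (hp : p < w.length) (c : Fin (D + 1))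
    (x : ZMod m × Fin (D + 1)) :
    (raceTable delay k).E w (some (Sum.inl x)) *ᵥ Pi.single (runnerConfig delay k w j p c) 1 =
      0 := by
  rw [race_E_runnerConfig_of_lt _ _ _ _ _ hp, if_neg]
  simp only [raceMove]
  split_ifs <;> simp

theorem race_E_none_runnerConfig_length (j : J) (c : Fin (D + 1)) :
    (raceTable delay k).E w none *ᵥ Pi.single (runnerConfig (m := m) delay k w j w.length c) 1 =
      0 := by
  have hs : scan w (headsAt k w (w.length + 1)) 0 = TapeSymbol.rightEnd :=
    scan_eq_rightEnd_iff.2 (val_headsAt_zero le_rfl)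
  rw [(raceTable_staysOnTape delay k).E_mulVec_single]
  refine Finset.sum_eq_zero fun q _ => ?_
  simp [runnerConfig, hs, raceVector]

theorem race_E_inl_runnerConfig_length (j : J) (c : Fin (D + 1)) (x : ZMod m × Fin (D + 1)) :
    (raceTable delay k).E w (some (Sum.inl x)) *ᵥ
      Pi.single (runnerConfig (m := m) delay k w j w.length c) 1 =
      if x = ((w.length : ZMod m), c) then raceAmp J • Pi.single (finishConfig delay k w) 1
      else 0 := by
  have hs : scan w (headsAt k w (w.length + 1)) 0 = TapeSymbol.rightEnd :=
    scan_eq_rightEnd_iff.2 (val_headsAt_zero le_rfl)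
  rw [(raceTable_staysOnTape delay k).E_mulVec_single, Finset.sum_eq_single none]
  · simp only [runnerConfig, hs, finishConfig, advance_false]
    by_cases h : x = ((w.length : ZMod m), c)
    · simp [raceVector, h]
    · have h' : ¬ ((none, some (Sum.inl x)) : RaceState J m D × RaceSymbol J m D) =
          (none, some (Sum.inl ((w.length : ZMod m), c))) := by
        simpa using h
      rw [if_neg h]
      simp [raceVector, h]
  · intro q _ hq
    simp [runnerConfig, hs, raceVector, hq]
  · intro h
    exact absurd (Finset.mem_univ _) h

theorem race_E_init (ω : RaceSymbol J m D) :
    (raceTable delay k).E w ω *ᵥ Pi.single ((raceTable (m := m) (D := D) delay k).init w) 1 =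
      if ω = none then raceAmp J • ∑ j, Pi.single (runnerConfig delay k w j 0 0) 1 else 0 := by
  have hs : scan w (fun _ : Fin (k + 1) => startPos w) 0 = TapeSymbol.leftEnd :=
    scan_of_val_eq_zero rfl
  have hadv := advance_headsAt (D := D) k (w := w) (p := 0) (Nat.zero_le _) 0
  rw [if_pos rfl, headsAt_zero] at hadv
  rw [(raceTable_staysOnTape delay k).E_mulVec_single]
  simp only [QuantumTable.init, hs, raceVector]
  split_ifs with h
  · subst h
    simp only [Pi.smul_apply, Finset.sum_apply, smul_eq_mul, mul_smul, ← Finset.smul_sum,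
      Finset.sum_smul]
    rw [Finset.sum_comm]
    congr 1
    refine Finset.sum_congr rfl fun j _ => ?_
    rw [Finset.sum_eq_single (some (j, 0, 0))]
    · rw [Pi.single_eq_same, one_smul]
      rw [runnerConfig, Nat.cast_zero]
      exact congrArg (fun c => (Pi.single c (1 : ℂ) : (raceTable delay k).Config w → ℂ))
        (Prod.ext rfl hadv)
    · intro q _ hq
      rw [Pi.single_eq_of_ne, zero_smul]
      exact fun h' => hq (congrArg Prod.fst h')
    · intro h
      exact absurd (Finset.mem_univ _) h
  · refine Finset.sum_eq_zero fun q _ => ?_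
    simp [h]

/-- The number of steps in which the runner `j` gets from the letter at position `p` to the right
end-marker. -/
def raceTime (w : List Γ) (p : ℕ) (j : J) : ℕ :=
  suffixSum (fun p a => delay j (p : ZMod m) a + 1) w p

/-- A runner can be accepted only in the step after its remaining running time, which is `raceTime`
less the `c` steps already spent on the square. The residue and counter on the register are then the
same for all runners. -/
theorem race_E_inl_pow (hD : ∀ j r a, delay j r a ≤ D) (x : ZMod m × Fin (D + 1)) (j : J) (t : ℕ)
    {p : ℕ} (hp : p ≤ w.length) (c : Fin (D + 1))
    (hlt : ∀ h : p < w.length, (c : ℕ) ≤ delay j (p : ZMod m) w[p])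
    (hend : p = w.length → c = 0) :
    (raceTable delay k).E w (some (Sum.inl x)) *ᵥ ((raceTable delay k).E w none ^ t *ᵥ
      Pi.single (runnerConfig delay k w j p c) 1) =
      if t + c = raceTime delay w p j ∧ x = ((w.length : ZMod m), 0) then
        raceAmp J • Pi.single (finishConfig delay k w) 1 else 0 := by
  induction t generalizing p c with
  | zero =>
    rw [pow_zero, Matrix.one_mulVec]
    rcases hp.lt_or_eq with hp | rfl
    · rw [race_E_inl_runnerConfig_of_lt _ _ _ _ hp, if_neg]
      rintro ⟨h, -⟩
      rw [raceTime, suffixSum_of_lt _ hp] at h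
      have := hlt hp
      omega
    · obtain rfl := hend rfl
      rw [race_E_inl_runnerConfig_length, raceTime, suffixSum_length]
      simp
  | succ t ih =>
    rw [pow_succ, ← Matrix.mulVec_mulVec]
    rcases hp.lt_or_eq with hp | rfl
    · have hT : raceTime delay w p j =
          delay j (p : ZMod m) w[p] + 1 + raceTime delay w (p + 1) j := suffixSum_of_lt _ hp
      rcases (hlt hp).lt_or_eq with hc | hc
      · have hcD : (c : ℕ) < D := hc.trans_le (hD _ _ _)
        rw [race_E_none_runnerConfig_of_lt_delay _ _ _ _ hp c hc hcD,
          ih hp.le ⟨c + 1, Nat.succ_lt_succ hcD⟩ (fun _ => hc) (fun h => absurd h hp.ne)]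
        simp only [show t + (c + 1) = t + 1 + (c : ℕ) by omega]
      · rw [race_E_none_runnerConfig_of_eq_delay _ _ _ _ hp c hc,
          ih hp 0 (fun _ => Nat.zero_le _) (fun _ => rfl)]
        have : t + ((0 : Fin (D + 1)) : ℕ) = raceTime delay w (p + 1) j ↔
            t + 1 + (c : ℕ) = raceTime delay w p j := by
          rw [hT, Fin.val_zero]
          omega
        simp only [this]
    · rw [race_E_none_runnerConfig_length, Matrix.mulVec_zero, Matrix.mulVec_zero, if_neg]
      rintro ⟨h, -⟩
      rw [raceTime, suffixSum_length] at h
      omega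

/-- The accepting symbol does not name the runner, so simultaneous arrivals add amplitudes: each
contributes 1/√N from the start times 1/√N from the end. The `+ 1` is the step off the left
end-marker. -/
theorem race_acceptProbAt (hD : ∀ j r a, delay j r a ≤ D) (t : ℕ) :
    (raceTable (D := D) delay k).acceptProbAt w t =
      (((Finset.univ.filter fun j => raceTime delay w 0 j + 1 = t).card : ℝ) /
        Fintype.card J) ^ 2 := by
  have hd := QuantumTable.density_eq_vecMulVec (M := raceTable (D := D) delay k) w
    (fun t => (raceTable delay k).E w none ^ t *ᵥ Pi.single ((raceTable delay k).init w) 1)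
    (fun _ => none) (by rw [pow_zero, Matrix.one_mulVec]) (fun _ => rfl)
    (fun t => by rw [pow_succ', ← Matrix.mulVec_mulVec])
    (fun t ω hω hne => by rcases ω with _ | _ | _ <;> simp at hω hne) t
  have key : ∀ x : ZMod m × Fin (D + 1), (raceTable delay k).E w (some (Sum.inl x)) *ᵥ
      ((raceTable delay k).E w none ^ t *ᵥ Pi.single ((raceTable delay k).init w) 1) =
      if x = ((w.length : ZMod m), 0) then
        (((Finset.univ.filter fun j => raceTime delay w 0 j + 1 = t).card : ℂ) /
          Fintype.card J) • Pi.single (finishConfig delay k w) 1 else 0 := by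
    intro x
    rcases t with _ | t
    · rw [pow_zero, Matrix.one_mulVec, race_E_init]
      simp
    · rw [pow_succ, ← Matrix.mulVec_mulVec, race_E_init, if_pos rfl, Matrix.mulVec_smul,
        Matrix.mulVec_smul, Matrix.mulVec_sum, Matrix.mulVec_sum]
      have h : ∀ j, (raceTable delay k).E w (some (Sum.inl x)) *ᵥ
          ((raceTable delay k).E w none ^ t *ᵥ Pi.single (runnerConfig delay k w j 0 0) 1) = _ :=
        fun j => race_E_inl_pow delay k w hD x j t (Nat.zero_le _) 0 (fun _ => Nat.zero_le _)
          (fun _ => rfl)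
      simp only [h]
      by_cases hx : x = ((w.length : ZMod m), 0)
      · simp only [hx, and_true, if_true]
        rw [← Finset.sum_filter, Finset.sum_const, ← Nat.cast_smul_eq_nsmul ℂ, smul_smul,
          smul_smul, mul_right_comm, raceAmp_mul_self, div_eq_inv_mul]
        simp [eq_comm]
      · simp [hx]
  rw [QuantumTable.acceptProbAt_of_density_eq hd,
    Finset.sum_eq_single_of_mem (some (Sum.inl ((w.length : ZMod m), 0))) (by simp)]
  · rw [key, if_pos rfl, Finset.sum_eq_single (finishConfig delay k w)]
    · simp
    · intro c _ hc
      simp [hc]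
    · simp
  · rintro (_ | x | x) hω hne
    · simp at hω
    · rw [key, if_neg (fun h => hne (by rw [h]))]
      simp
    · simp at hω

theorem race_acceptProb_ge_one [Nonempty J] (hD : ∀ j r a, delay j r a ≤ D) {T : ℕ}
    (hT : ∀ j, raceTime delay w 0 j = T) : 1 ≤ (raceTable (D := D) delay k).acceptProb w := by
  refine le_trans ?_ (ENNReal.le_tsum (T + 1))
  rw [race_acceptProbAt _ _ _ hD]
  simp [hT]

/-- If g ≤ B runners arrive at a given time, then (g/N)² ≤ g · B/N². Each runner therefore
contributes at most B/N² in total, at its own arrival time. -/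
theorem race_acceptProb_le [Nonempty J] (hD : ∀ j r a, delay j r a ≤ D) {B : ℕ}
    (hB : ∀ T, (Finset.univ.filter fun j => raceTime delay w 0 j = T).card ≤ B) :
    (raceTable (D := D) delay k).acceptProb w ≤ ENNReal.ofReal (B / Fintype.card J) := by
  have hN : (0 : ℝ) < Fintype.card J := by exact_mod_cast Fintype.card_pos
  set b : ℝ := B / (Fintype.card J : ℝ) ^ 2 with hb
  calc (raceTable (D := D) delay k).acceptProb w
      ≤ ∑' t, ∑ j : J, if t = raceTime delay w 0 j + 1 then ENNReal.ofReal b else 0 := by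
        refine ENNReal.tsum_le_tsum fun t => ?_
        rw [race_acceptProbAt _ _ _ hD, ← Finset.sum_filter, Finset.sum_const, nsmul_eq_mul,
          ← ENNReal.ofReal_natCast, ← ENNReal.ofReal_mul (Nat.cast_nonneg _)]
        simp only [eq_comm (a := t)]
        refine ENNReal.ofReal_le_ofReal ?_
        set g := (Finset.univ.filter fun j => raceTime delay w 0 j + 1 = t).card with hg
        have hgB : g ≤ B := by
          rcases t with _ | t
          · simp [hg]
          · simpa [hg] using hB t
        have hgB' : (g : ℝ) ≤ B := by exact_mod_cast hgB
        rw [hb, div_pow, sq (g : ℝ), ← mul_div_assoc]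
        gcongr
    _ = ∑ j : J, ENNReal.ofReal b := by
        rw [Summable.tsum_finsetSum fun _ _ => ENNReal.summable]
        exact Finset.sum_congr rfl fun j _ => tsum_ite_eq _ _
    _ = ENNReal.ofReal (B / Fintype.card J) := by
        rw [Finset.sum_const, nsmul_eq_mul, ← ENNReal.ofReal_natCast,
          ← ENNReal.ofReal_mul (Nat.cast_nonneg _), Finset.card_univ, hb]
        congr 1
        field_simp

end Race

/-! ### Delays that encode the fingerprint -/

open Classical in
/-- The delays for which the sum over a word is, up to a number that does not depend on `j`, the
value at `j` of a polynomial whose coefficients are the excesses of the word. -/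
noncomputable def balanceDelay {Γ : Type} (α : Γ) (m N : ℕ) (j : Fin N) (r : ZMod m) (a : Γ) : ℕ :=
  if a = α then (j : ℕ) ^ (r.val + 1) else N ^ m - (j : ℕ) ^ (r.val + 1)

theorem exists_raceTime_balanceDelay {Γ : Type} (α : Γ) (m N : ℕ) [NeZero m] (w : List Γ) :
    ∃ C : ℤ, ∀ j, (raceTime (balanceDelay α m N) w 0 j : ℤ) =
      ∑ i, excess α m w i * (j : ℤ) ^ (i.val + 1) + C := by
  classical
  -- The constant collects what is independent of the runner: one moving step per letter, and the
  -- offset `N ^ m` that keeps the delays on letters other than `α` nonnegative.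
  refine ⟨suffixSum (fun _ a => if a = α then 1 else (N : ℤ) ^ m + 1) w 0, fun j => ?_⟩
  rw [sum_excess_mul, raceTime, suffixSum, suffixSum, suffixSum, ← Finset.sum_add_distrib]
  push_cast
  refine Finset.sum_congr rfl fun p _ => ?_
  cases w[p]? with
  | none => simp
  | some a =>
    have h : (j : ℕ) ^ ((p : ZMod m).val + 1) ≤ N ^ m :=
      (Nat.pow_le_pow_left j.2.le _).trans
        (Nat.pow_le_pow_right (Nat.zero_lt_of_lt j.2) (ZMod.val_lt _))
    simp only [Option.elim_some, balanceDelay, sign]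
    split_ifs
    · push_cast; ring
    · rw [Nat.cast_add, Nat.cast_sub h]; push_cast; ring

theorem balanced_mem_quantumClass {Γ : Type} (α : Γ) (m : ℕ) [NeZero m] (k : ℕ) {ε : ℝ}
    (hε : 0 < ε) : balanced α m ∈ quantumClass Γ (k + 1) ε := by
  obtain ⟨N, hN⟩ := exists_nat_gt (m / ε)
  have hN0 : (0 : ℝ) < N := lt_of_le_of_lt (by positivity) hN
  have hNpos : 0 < N := by exact_mod_cast hN0
  have : NeZero N := ⟨hNpos.ne'⟩
  have hD : ∀ j r a, balanceDelay α m N j r a ≤ N ^ m := by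
    intro j r a
    unfold balanceDelay
    split_ifs
    · exact (Nat.pow_le_pow_left j.2.le _).trans (Nat.pow_le_pow_right hNpos (ZMod.val_lt r))
    · exact Nat.sub_le _ _
  refine ⟨⟨raceTable (D := N ^ m) (balanceDelay α m N) k, raceTable_wellFormed _ k⟩,
    fun w hw => ?_, fun w hw => ?_⟩
  · obtain ⟨C, hC⟩ := exists_raceTime_balanceDelay α m N w
    refine le_trans (ENNReal.ofReal_le_one.2 (by linarith)) (race_acceptProb_ge_one _ k w hD
      (T := raceTime (balanceDelay α m N) w 0 0) fun j => ?_)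
    have h0 : ∀ j : Fin N, ∑ i, excess α m w i * (j : ℤ) ^ (i.val + 1) = 0 := fun j =>
      Finset.sum_eq_zero fun i _ => by rw [hw i, zero_mul]
    have h1 := hC j
    have h2 := hC 0
    rw [h0, zero_add] at h1 h2
    exact_mod_cast h1.trans h2.symm
  · obtain ⟨C, hC⟩ := exists_raceTime_balanceDelay α m N w
    refine (race_acceptProb_le _ k w hD (B := m) fun T => ?_).trans (ENNReal.ofReal_le_ofReal ?_)
    · refine le_trans (Finset.card_le_card fun j hj => ?_)
        (card_filter_sum_mul_pow_eq_le ((notMem_balanced_iff α).1 hw) N (T - C))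
      rw [Finset.mem_filter] at hj ⊢
      refine ⟨hj.1, ?_⟩
      have h1 := hC j
      rw [hj.2] at h1
      linarith
    · rw [Fintype.card_fin, div_le_iff₀ hN0]
      rw [div_lt_iff₀ hε] at hN
      linarith

/-! ### Deterministic runs on a tape of fixed length, and their splicing -/

/-- A head on one of the squares `0, …, L + 1` stays or moves to the right, but not beyond the last
square. -/
def moveOn {L : ℕ} (x : Fin (L + 2)) (d : Bool) : Fin (L + 2) :=
  if h : d = true ∧ (x : ℕ) < L + 1 then ⟨x + 1, by omega⟩ else x

theorem val_moveOn {L : ℕ} (x : Fin (L + 2)) (d : Bool) :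
    (moveOn x d : ℕ) = if d = true ∧ (x : ℕ) < L + 1 then (x : ℕ) + 1 else x := by
  unfold moveOn; split_ifs <;> rfl

namespace DetFA

variable {Γ : Type} {k : ℕ} (M : DetFA Γ k)

section Abstract

variable (L : ℕ)

/-- A step on the squares `0, …, L + 1` of a tape that carries the symbols `f`. -/
def tapeStep (f : ℕ → TapeSymbol Γ) (c : M.Q × (Fin k → Fin (L + 2))) :
    M.Q × (Fin k → Fin (L + 2)) :=
  match M.δ c.1 (fun i => f (c.2 i)) with
  | none => c
  | some pd => (pd.1, fun i => moveOn (c.2 i) (pd.2 i))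

/-- The run on a tape that carries the symbols `f`. -/
def tapeRun (f : ℕ → TapeSymbol Γ) (t : ℕ) : M.Q × (Fin k → Fin (L + 2)) :=
  (M.tapeStep L f)^[t] (M.q₀, fun _ => 0)

/-- The run on the tape with symbols `f` halts in an accepting state. -/
def TapeAccepts (f : ℕ → TapeSymbol Γ) : Prop :=
  ∃ t, M.δ (M.tapeRun L f t).1 (fun i => f ((M.tapeRun L f t).2 i)) = none ∧
    (M.tapeRun L f t).1 ∈ M.Qa

variable {M L}

theorem tapeRun_succ (f : ℕ → TapeSymbol Γ) (t : ℕ) :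
    M.tapeRun L f (t + 1) = M.tapeStep L f (M.tapeRun L f t) :=
  Function.iterate_succ_apply' _ _ _

theorem tapeStep_congr {f g : ℕ → TapeSymbol Γ} {c : M.Q × (Fin k → Fin (L + 2))}
    (h : ∀ i, f (c.2 i) = g (c.2 i)) : M.tapeStep L f c = M.tapeStep L g c := by
  have : (fun i => f (c.2 i)) = fun i => g (c.2 i) := funext h
  simp only [tapeStep, this]

theorem le_tapeStep (f : ℕ → TapeSymbol Γ) (c : M.Q × (Fin k → Fin (L + 2))) :
    c.2 ≤ (M.tapeStep L f c).2 := by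
  intro i
  unfold tapeStep
  split
  · exact le_rfl
  · rw [Fin.le_def, val_moveOn]
    split_ifs
    · exact Nat.le_succ _
    · exact le_rfl

theorem monotone_tapeRun (f : ℕ → TapeSymbol Γ) : Monotone fun t => (M.tapeRun L f t).2 :=
  monotone_nat_of_le_succ fun t => by rw [tapeRun_succ]; exact le_tapeStep f _

theorem tapeRun_add_of_halts {f : ℕ → TapeSymbol Γ} {t : ℕ}
    (h : M.δ (M.tapeRun L f t).1 (fun i => f ((M.tapeRun L f t).2 i)) = none) (s : ℕ) :
    M.tapeRun L f (t + s) = M.tapeRun L f t := by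
  induction s with
  | zero => rfl
  | succ s ih => rw [← add_assoc, tapeRun_succ, ih, tapeStep, h]

open Classical in
variable (M L) in
/-- The configuration in which the head `h` first scans a square of the block `b`. -/
noncomputable def entry (blk : ℕ → ℕ) (f : ℕ → TapeSymbol Γ) (b : ℕ) (h : Fin k) :
    Option (M.Q × (Fin k → Fin (L + 2))) :=
  if H : ∃ t, blk ((M.tapeRun L f t).2 h) = b then some (M.tapeRun L f (Nat.find H)) else none

/-- A one-way head that moves into a block from outside cannot have scanned it earlier, so this
entrance is the first. -/
theorem entry_eq_some {blk : ℕ → ℕ} (hblk : Monotone blk) {f : ℕ → TapeSymbol Γ} {b t : ℕ}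
    {h : Fin k} (h0 : blk ((M.tapeRun L f t).2 h) ≠ b)
    (h1 : blk ((M.tapeRun L f (t + 1)).2 h) = b) :
    M.entry L blk f b h = some (M.tapeRun L f (t + 1)) := by
  classical
  have H : ∃ t, blk ((M.tapeRun L f t).2 h) = b := ⟨_, h1⟩
  have : Nat.find H = t + 1 := by
    refine le_antisymm (Nat.find_min' H h1) (not_lt.1 fun hlt => h0 ?_)
    have hle : Nat.find H ≤ t := Nat.lt_succ_iff.1 hlt
    refine le_antisymm ?_ ?_
    · rw [← h1]
      exact hblk (monotone_tapeRun f (Nat.le_succ t) h)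
    · conv_lhs => rw [← Nat.find_spec H]
      exact hblk (monotone_tapeRun f hle h)
  rw [entry, dif_pos H, this]

theorem exists_of_entry_eq_some {blk : ℕ → ℕ} {f : ℕ → TapeSymbol Γ} {b : ℕ} {h : Fin k}
    {c : M.Q × (Fin k → Fin (L + 2))} (hc : M.entry L blk f b h = some c) :
    ∃ t, M.tapeRun L f t = c := by
  classical
  unfold entry at hc
  split_ifs at hc with H
  exact ⟨_, Option.some_injective _ hc⟩

variable (M L) in
/-- No head ever scans the block `i` while a head scans the block `j`. -/
def Separates (blk : ℕ → ℕ) (f : ℕ → TapeSymbol Γ) (i j : ℕ) : Prop :=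
  ∀ t h h', ¬(blk ((M.tapeRun L f t).2 h) = i ∧ blk ((M.tapeRun L f t).2 h') = j)

theorem Separates.symm {blk : ℕ → ℕ} {f : ℕ → TapeSymbol Γ} {i j : ℕ}
    (h : M.Separates L blk f i j) : M.Separates L blk f j i :=
  fun t a b hab => h t b a hab.symm

/-- Following a run outside of a block, up to a switch to the run `g`. -/
theorem follow {blk : ℕ → ℕ} (hblk : Monotone blk) {i j : ℕ} {f g e : ℕ → TapeSymbol Γ}
    (hf : ∀ p, blk p ≠ j → e p = f p) (hg : M.Separates L blk g i j)
    (hent : ∀ h, M.entry L blk f j h = M.entry L blk g j h) {t a : ℕ}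
    (hta : M.tapeRun L e t = M.tapeRun L f a)
    (ha : ∀ h, blk ((M.tapeRun L f a).2 h) ≠ j) :
    M.tapeRun L e (t + 1) = M.tapeRun L f (a + 1) ∧
      ((∀ h, blk ((M.tapeRun L f (a + 1)).2 h) ≠ j) ∨
        ∃ b, M.tapeRun L e (t + 1) = M.tapeRun L g b ∧
          ∀ h, blk ((M.tapeRun L g b).2 h) ≠ i) := by
  have hstep : M.tapeRun L e (t + 1) = M.tapeRun L f (a + 1) := by
    rw [tapeRun_succ, tapeRun_succ, hta]
    exact tapeStep_congr fun h => hf _ (ha h)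
  refine ⟨hstep, ?_⟩
  by_cases hne : ∀ h, blk ((M.tapeRun L f (a + 1)).2 h) ≠ j
  · exact Or.inl hne
  · push Not at hne
    obtain ⟨h, hh⟩ := hne
    -- A head has just entered the block `j`. This configuration also occurs in the run on `g`,
    -- where separation guarantees that no head is in the block `i`.
    have h1 := entry_eq_some hblk (ha h) hh
    rw [hent h] at h1
    obtain ⟨b, hb⟩ := exists_of_entry_eq_some h1
    refine Or.inr ⟨b, hstep.trans hb.symm, fun h' h'i => hg b h' h ⟨h'i, ?_⟩⟩
    rw [hb]
    exact hh

/-- Once the heads rest for good on squares where the two tapes agree, the runs coincide forever up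
to a time shift, so acceptance carries over. -/
theorem accepts_of_follow {blk : ℕ → ℕ} {j : ℕ} {f e : ℕ → TapeSymbol Γ}
    (hf : ∀ p, blk p ≠ j → e p = f p) (hacc : M.TapeAccepts L f) {t a : ℕ}
    (hta : M.tapeRun L e t = M.tapeRun L f a)
    (hj : ∀ h, blk ((M.tapeRun L f a).2 h) ≠ j)
    (hconst : ∀ u, t ≤ u → (M.tapeRun L e t).2 = (M.tapeRun L e u).2) :
    M.TapeAccepts L e := by
  have key : ∀ s, M.tapeRun L e (t + s) = M.tapeRun L f (a + s) := by
    intro s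
    induction s with
    | zero => exact hta
    | succ s ih =>
      rw [← add_assoc, ← add_assoc, tapeRun_succ, tapeRun_succ, ih]
      refine tapeStep_congr fun h => hf _ ?_
      rw [← ih, ← hconst (t + s) (Nat.le_add_right _ _), hta]
      exact hj h
  obtain ⟨u, hu, hua⟩ := hacc
  refine ⟨t + u, ?_⟩
  have heq : M.tapeRun L f (a + u) = M.tapeRun L f u := by
    rw [add_comm a u]; exact tapeRun_add_of_halts hu a
  have hpos : ∀ h, e ((M.tapeRun L e (t + u)).2 h) = f ((M.tapeRun L e (t + u)).2 h) := by
    intro h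
    apply hf
    rw [← hconst (t + u) (Nat.le_add_right _ _), hta]
    exact hj h
  simp only [hpos]
  rw [key, heq]
  exact ⟨hu, hua⟩

/-- If two accepted tapes differ only in the blocks `i` and `j`, which are never scanned at the same
time, and the blocks are entered in the same configurations, then the two tapes can be mixed. -/
theorem tapeAccepts_mix {blk : ℕ → ℕ} (hblk : Monotone blk) {i j : ℕ} (hj : blk 0 ≠ j)
    {f g e : ℕ → TapeSymbol Γ}
    (hf : ∀ p, blk p ≠ j → e p = f p) (hg : ∀ p, blk p ≠ i → e p = g p)
    (hsf : M.Separates L blk f i j) (hsg : M.Separates L blk g i j)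
    (hi_ent : ∀ h, M.entry L blk f i h = M.entry L blk g i h)
    (hj_ent : ∀ h, M.entry L blk f j h = M.entry L blk g j h)
    (hfa : M.TapeAccepts L f) (hga : M.TapeAccepts L g) : M.TapeAccepts L e := by
  -- The run on `e` always coincides with the run on `f` outside the block `j` or with the run on
  -- `g` outside the block `i`; the times `a` and `b` need not equal `t`.
  have inv : ∀ t,
      (∃ a, M.tapeRun L e t = M.tapeRun L f a ∧ ∀ h, blk ((M.tapeRun L f a).2 h) ≠ j) ∨
      (∃ b, M.tapeRun L e t = M.tapeRun L g b ∧ ∀ h, blk ((M.tapeRun L g b).2 h) ≠ i) := by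
    intro t
    induction t with
    | zero => exact Or.inl ⟨0, rfl, fun _ => hj⟩
    | succ t ih =>
      rcases ih with ⟨a, hta, ha⟩ | ⟨b, htb, hb⟩
      · obtain ⟨h1, h2 | h2⟩ := follow hblk hf hsg hj_ent hta ha
        · exact Or.inl ⟨_, h1, h2⟩
        · exact Or.inr h2
      · obtain ⟨h1, h2 | h2⟩ := follow hblk hg hsf.symm (fun h => (hi_ent h).symm) htb hb
        · exact Or.inr ⟨_, h1, h2⟩
        · exact Or.inl h2
  -- The monotone head positions are bounded and hence eventually constant; from then on no more
  -- switches are needed.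
  obtain ⟨t, ht⟩ := WellFoundedGT.monotone_chain_condition
    (⟨fun t => (M.tapeRun L e t).2, monotone_tapeRun e⟩ : ℕ →o (Fin k → Fin (L + 2)))
  rcases inv t with ⟨a, hta, ha⟩ | ⟨b, htb, hb⟩
  · exact accepts_of_follow hf hfa hta ha ht
  · exact accepts_of_follow hg hga htb hb ht

/-- With many blocks, some two of them are separated. -/
theorem exists_separates {blk : ℕ → ℕ} (hblk : Monotone blk) (f : ℕ → TapeSymbol Γ) {s : ℕ}
    (hs : 2 * k * k + 1 < s) :
    ∃ p : Fin s × Fin s, p.1 ≠ p.2 ∧ M.Separates L blk f (p.1 + 1) (p.2 + 1) := by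
  by_contra! hcon
  have hcov : ∀ p : Fin s × Fin s, ∃ x : (Fin k × Fin k) × ℕ, p.1 ≠ p.2 →
      blk ((M.tapeRun L f x.2).2 x.1.1) = p.1 + 1 ∧
      blk ((M.tapeRun L f x.2).2 x.1.2) = p.2 + 1 := by
    intro p
    by_cases hp : p.1 = p.2
    · have hk : Nonempty ((Fin k × Fin k) × ℕ) := by
        by_contra hk
        rw [not_nonempty_iff] at hk
        exact hcon (⟨0, by omega⟩, ⟨1, by omega⟩) (by simp)
          fun t h h' => (hk.false ((h, h'), t)).elim
      exact ⟨hk.some, fun h => absurd hp h⟩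
    · have := hcon p hp
      simp only [Separates, not_forall, not_not] at this
      obtain ⟨t, h, h', hh⟩ := this
      exact ⟨((h, h'), t), fun _ => hh⟩
  choose x hx using hcov
  -- The pair of heads and the sum of the block numbers determine the ordered pair of blocks:
  -- between two times both block numbers can only grow, so equal sums mean equal numbers. This
  -- would give s(s - 1) ≤ k² · 2s, contrary to s > 2k² + 1.
  have hcard : (Finset.univ : Finset (Fin s)).offDiag.card ≤
      (Finset.univ : Finset ((Fin k × Fin k) × Fin (2 * s))).card := by
    refine Finset.card_le_card_of_injOn
      (fun p => ((x p).1, ⟨p.1 + p.2, by omega⟩)) (fun _ _ => Finset.mem_coe.2 (Finset.mem_univ _)) ?_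
    have key : ∀ p q : Fin s × Fin s, p.1 ≠ p.2 → q.1 ≠ q.2 → (x p).1 = (x q).1 →
        (p.1 : ℕ) + p.2 = q.1 + q.2 → (x p).2 ≤ (x q).2 → p = q := by
      intro p q hp hq h1 h2 hle
      obtain ⟨hp1, hp2⟩ := hx p hp
      obtain ⟨hq1, hq2⟩ := hx q hq
      have m1 := hblk (monotone_tapeRun (M := M) (L := L) f hle (x q).1.1)
      have m2 := hblk (monotone_tapeRun (M := M) (L := L) f hle (x q).1.2)
      rw [h1] at hp1 hp2
      dsimp only at m1 m2
      exact Prod.ext (Fin.ext (by omega)) (Fin.ext (by omega))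
    intro p hp q hq h
    simp only [Finset.coe_offDiag, Set.mem_offDiag] at hp hq
    simp only [Prod.mk.injEq, Fin.mk.injEq] at h
    rcases le_total (x p).2 (x q).2 with hle | hle
    · exact key p q hp.2.2 hq.2.2 h.1 h.2 hle
    · exact (key q p hq.2.2 hp.2.2 h.1.symm h.2.symm hle).symm
  simp only [Finset.offDiag_card, Finset.card_univ, Fintype.card_prod, Fintype.card_fin] at hcard
  have h2 : (2 * k * k + 1) * s < s * s := Nat.mul_lt_mul_of_pos_right hs (by omega)
  have h3 : (2 * k * k + 1) * s = k * k * (2 * s) + s := by ring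
  omega

end Abstract

/-- The symbols on the tape `¢ w $`, continued by right end-markers. -/
def symbolAt (w : List Γ) (p : ℕ) : TapeSymbol Γ := (tape w).getD p TapeSymbol.rightEnd

/-- The squares of the tape are numbered from `0` to `|w| + 1`. -/
def numbered {M : DetFA Γ k} {w : List Γ} (c : M.Config w) : M.Q × (Fin k → Fin (w.length + 2)) :=
  (c.1, fun i => (c.2 i).cast (length_tape w))

theorem symbolAt_cast (w : List Γ) (x : Pos w) :
    symbolAt w (x.cast (length_tape w)) = (tape w).get x := by
  simp [symbolAt]

theorem numbered_step (w : List Γ) (c : M.Config w) :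
    numbered (M.step w c) = M.tapeStep w.length (symbolAt w) (numbered c) := by
  have : (fun i => symbolAt w ((numbered c).2 i)) = scan w c.2 :=
    funext fun i => symbolAt_cast w (c.2 i)
  unfold tapeStep step
  rw [this]
  change numbered (match M.δ c.1 (scan w c.2) with
    | none => c
    | some pd => (pd.1, fun i => advance w (c.2 i) (pd.2 i))) = match M.δ c.1 (scan w c.2) with
    | none => _
    | some pd => _
  cases M.δ c.1 (scan w c.2) with
  | none => rfl
  | some pd =>
    refine Prod.ext rfl (funext fun i => Fin.ext ?_)
    exact (val_advance w (c.2 i) (pd.2 i)).trans (val_moveOn ((numbered c).2 i) (pd.2 i)).symm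

theorem numbered_iterate (w : List Γ) (t : ℕ) :
    numbered ((M.step w)^[t] (M.init w)) = M.tapeRun w.length (symbolAt w) t :=
  Function.Semiconj.iterate_right (f := numbered)
    (ga := M.step w) (gb := M.tapeStep w.length (symbolAt w)) (M.numbered_step w) t (M.init w)

theorem mem_language_iff_tapeAccepts (w : List Γ) :
    w ∈ M.language ↔ M.TapeAccepts w.length (symbolAt w) := by
  refine exists_congr fun t => ?_
  rw [← M.numbered_iterate w t, HaltedAccepting]
  have : (fun i => symbolAt w ((numbered ((M.step w)^[t] (M.init w))).2 i)) =
      scan w ((M.step w)^[t] (M.init w)).2 := funext fun i => symbolAt_cast w _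
  rw [this]
  rfl

end DetFA

/-! ### Words built from tables of letter counts -/

section Words

variable {Γ : Type} (α β : Γ) (m : ℕ)

/-- In row `a` and residue `r` (that is, at the position congruent to `r` among the positions
`m * a, …, m * a + m - 1`), the letter `α` or `β` of the word given by `V` and `z`. The first `s * n`
rows form `s` blocks of `n` rows, and the block `t` has `V t r` letters `α` in residue `r`; the
remaining rows have `z r` of them. -/
def blockLetter (n s : ℕ) (V : ℕ → ZMod m → ℕ) (z : ZMod m → ℕ) (a : ℕ) (r : ZMod m) : Γ :=
  if a < s * n then (if a % n < V (a / n) r then α else β)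
  else if a - s * n < z r then α else β

/-- The word with the letters `blockLetter`. -/
def blockWord (n s : ℕ) (V : ℕ → ZMod m → ℕ) (z : ZMod m → ℕ) : List Γ :=
  List.ofFn fun p : Fin (m * (s * n + s * n)) => blockLetter α β m n s V z (p / m) (p : ℕ)

theorem length_blockWord (n s : ℕ) (V : ℕ → ZMod m → ℕ) (z : ZMod m → ℕ) :
    (blockWord α β m n s V z).length = m * (s * n + s * n) := by
  simp [blockWord]

theorem sum_range_mul_div_mod {A : Type*} [AddCommMonoid A] (G : ℕ → ℕ → A) (n s : ℕ) :
    ∑ a ∈ Finset.range (s * n), G (a / n) (a % n) =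
      ∑ t ∈ Finset.range s, ∑ b ∈ Finset.range n, G t b := by
  induction s with
  | zero => simp
  | succ s ih =>
    rw [Nat.succ_mul, Finset.sum_range_add, ih, Finset.sum_range_succ]
    congr 1
    refine Finset.sum_congr rfl fun b hb => ?_
    rw [Finset.mem_range] at hb
    rw [mul_comm s n, Nat.mul_add_div (by omega), Nat.div_eq_of_lt hb, add_zero, Nat.mul_add_mod,
      Nat.mod_eq_of_lt hb]

theorem sum_range_ite_lt {v n : ℕ} (hv : v ≤ n) :
    ∑ b ∈ Finset.range n, (if b < v then (1 : ℤ) else -1) = 2 * v - n := by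
  have h : ∀ n : ℕ, ∑ b ∈ Finset.range n, (if b < v then (1 : ℤ) else -1) =
      2 * (min v n : ℕ) - n := by
    intro n
    induction n with
    | zero => simp
    | succ n ih =>
      rw [Finset.sum_range_succ, ih]
      split_ifs with h
      · rw [min_eq_right h.le, min_eq_right (Nat.succ_le_of_lt h)]; push_cast; ring
      · rw [min_eq_left (by omega), min_eq_left (by omega)]; push_cast; ring
  rw [h, min_eq_left hv]

theorem sum_range_mul_residue [NeZero m] {A : Type*} [AddCommMonoid A] (F : ℕ → A) (R : ℕ)
    (i : ZMod m) :
    ∑ p ∈ Finset.range (m * R), (if (p : ZMod m) = i then F (p / m) else 0) =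
      ∑ a ∈ Finset.range R, F a := by
  have hm : 0 < m := NeZero.pos m
  rw [mul_comm]
  have h := sum_range_mul_div_mod (fun a b : ℕ => if (b : ZMod m) = i then F a else 0) m R
  simp only [ZMod.natCast_mod] at h
  rw [h]
  refine Finset.sum_congr rfl fun a _ => ?_
  rw [Finset.sum_eq_single i.val]
  · simp
  · intro b hb hne
    rw [if_neg]
    rintro rfl
    rw [ZMod.val_cast_of_lt (Finset.mem_range.1 hb)] at hne
    exact hne rfl
  · intro h
    exact absurd (Finset.mem_range.2 (ZMod.val_lt i)) h

variable {α β m}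

theorem excess_blockWord [NeZero m] (hαβ : β ≠ α) {n s : ℕ} {V : ℕ → ZMod m → ℕ} {z : ZMod m → ℕ}
    (hV : ∀ t i, V t i ≤ n) (hz : ∀ i, z i ≤ s * n) (i : ZMod m) :
    excess α m (blockWord α β m n s V z) i =
      2 * ((∑ t ∈ Finset.range s, V t i : ℕ) + z i - s * n : ℤ) := by
  have hsign : ∀ (P : Prop) [Decidable P], sign α (if P then α else β) = if P then 1 else -1 := by
    intro P _
    split_ifs <;> simp [sign, hαβ]
  have h1 : excess α m (blockWord α β m n s V z) i =
      ∑ p ∈ Finset.range (m * (s * n + s * n)), if (p : ZMod m) = i then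
        sign α (blockLetter α β m n s V z (p / m) i) else 0 := by
    rw [excess, blockWord, suffixSum_zero_ofFn _ _
      (fun p => blockLetter α β m n s V z (p / m) (p : ZMod m))]
    refine Finset.sum_congr rfl fun p _ => ?_
    split_ifs with h
    · rw [h]
    · rfl
  rw [h1, sum_range_mul_residue m (fun a => sign α (blockLetter α β m n s V z a i)),
    Finset.sum_range_add]
  have h2 : ∑ a ∈ Finset.range (s * n), sign α (blockLetter α β m n s V z a i) =
      ∑ t ∈ Finset.range s, (2 * (V t i : ℤ) - n) := by
    rw [← Finset.sum_congr rfl fun t _ => sum_range_ite_lt (hV t i),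
      ← sum_range_mul_div_mod (fun t b => if b < V t i then (1 : ℤ) else -1)]
    refine Finset.sum_congr rfl fun a ha => ?_
    rw [blockLetter, if_pos (Finset.mem_range.1 ha), hsign]
  have h3 : ∑ a ∈ Finset.range (s * n), sign α (blockLetter α β m n s V z (s * n + a) i) =
      2 * (z i : ℤ) - (s * n : ℕ) := by
    rw [← sum_range_ite_lt (hz i)]
    refine Finset.sum_congr rfl fun a _ => ?_
    rw [blockLetter, if_neg (by omega), hsign, Nat.add_sub_cancel_left]
  rw [h2, h3, Finset.sum_sub_distrib, ← Finset.mul_sum]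
  simp only [Finset.sum_const, Finset.card_range, nsmul_eq_mul]
  push_cast
  ring

/-- Each residue occurs once in every one of the 2sn rows, so balance means exactly sn letters `α`
in that residue. -/
theorem blockWord_mem_balanced_iff [NeZero m] (hαβ : β ≠ α) {n s : ℕ} {V : ℕ → ZMod m → ℕ}
    {z : ZMod m → ℕ} (hV : ∀ t i, V t i ≤ n) (hz : ∀ i, z i ≤ s * n) :
    blockWord α β m n s V z ∈ balanced α m ↔
      ∀ i, ∑ t ∈ Finset.range s, V t i + z i = s * n := by
  refine forall_congr' fun i => ?_
  rw [excess_blockWord hαβ hV hz]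
  constructor <;> intro h <;> zify at * <;> linarith

/-- The number of the block of rows in which the square `p` of the tape lies; the blocks are
numbered from `1`. -/
def blockOf (m n p : ℕ) : ℕ := (p + m * n - 1) / (m * n)

theorem monotone_blockOf (m n : ℕ) : Monotone (blockOf m n) := fun p q h =>
  Nat.div_le_div_right (by omega)

/-- The left end-marker forms block 0 by itself, so that all heads start outside the blocks to be
exchanged. -/
theorem blockOf_zero {m n : ℕ} (h : 0 < m * n) : blockOf m n 0 = 0 :=
  Nat.div_eq_of_lt (by omega)

theorem blockOf_succ {m n : ℕ} (h : 0 < m * n) (p : ℕ) :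
    blockOf m n (p + 1) = p / m / n + 1 := by
  rw [blockOf, show p + 1 + m * n - 1 = p + m * n by omega, Nat.add_div_right _ h,
    Nat.div_div_eq_div_mul]

theorem symbolAt_blockWord_congr {n s : ℕ} (h : 0 < m * n) {V V' : ℕ → ZMod m → ℕ}
    {z : ZMod m → ℕ} {j : ℕ} (hV : ∀ t, t ≠ j → V t = V' t) {p : ℕ}
    (hp : blockOf m n p ≠ j + 1) :
    DetFA.symbolAt (blockWord α β m n s V z) p = DetFA.symbolAt (blockWord α β m n s V' z) p := by
  rcases p with _ | p
  · simp [DetFA.symbolAt, tape]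
  · rw [blockOf_succ h] at hp
    have h' : V (p / m / n) = V' (p / m / n) := hV _ (by omega)
    have hl : blockLetter α β m n s V z (p / m) (p : ZMod m) =
        blockLetter α β m n s V' z (p / m) (p : ZMod m) := by
      simp only [blockLetter, h']
    simp only [DetFA.symbolAt, tape, List.getD_eq_getElem?_getD,
      List.getElem?_cons_succ]
    by_cases hlt : p < m * (s * n + s * n)
    · rw [List.getElem?_append_left (by simpa [blockWord] using hlt),
        List.getElem?_append_left (by simpa [blockWord] using hlt)]
      simp [blockWord, hlt, hl]
    · rw [List.getElem?_append_right (by simpa [blockWord] using hlt),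
        List.getElem?_append_right (by simpa [blockWord] using hlt)]
      simp [blockWord]

end Words

/-! ### Counting tables against observable data -/

theorem exists_card_bound (k q : ℕ) : ∃ n, 0 < n ∧
    (2 * k * k + 2) ^ 2 * (((n + 1) ^ (2 * k * k + 1)) ^ (2 * k * k) *
      (((2 * k * k + 2) * n + 1) ^ (2 * k * k + 1) *
        ((q * ((2 * k * k + 1) * ((2 * k * k + 2) * n + (2 * k * k + 2) * n) + 2) ^ k + 1) ^ 2) ^ k))
      < ((n + 1) ^ (2 * k * k + 1)) ^ (2 * k * k + 2) := by
  obtain ⟨K, hK⟩ : ∃ K, K = 2 * k * k := ⟨_, rfl⟩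
  rw [← hK]
  set s := K + 2 with hs
  set m := K + 1 with hm
  set D := (q + 1) * (2 * m * s) ^ k with hD
  set C := s ^ 2 * (s ^ m * D ^ (2 * k)) with hC
  have hDpos : 0 < D := by positivity
  have hCpos : 0 < C := by positivity
  -- With N = n + 1 the left side is at most C · N^(mK + m + K), and the right side is N^(mK + 2m),
  -- one power of N more because m = K + 1. As `C` does not depend on `n`, the choice n = C makes N
  -- exceed it.
  refine ⟨C, hCpos, ?_⟩
  set N := C + 1 with hN
  have h1 : s * C + 1 ≤ s * N := by rw [hN]; nlinarith
  have h2 : m * (s * C + s * C) + 2 ≤ 2 * m * s * N := by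
    have : 0 < m * s := by positivity
    rw [hN]; nlinarith
  have h3 : q * (m * (s * C + s * C) + 2) ^ k + 1 ≤ D * N ^ k := by
    calc _ ≤ q * (2 * m * s * N) ^ k + (2 * m * s * N) ^ k :=
          add_le_add (Nat.mul_le_mul_left _ (Nat.pow_le_pow_left h2 k))
            (Nat.one_le_pow _ _ (by positivity))
      _ = D * N ^ k := by rw [hD, mul_pow]; ring
  have h4 : ((q * (m * (s * C + s * C) + 2) ^ k + 1) ^ 2) ^ k ≤ D ^ (2 * k) * N ^ K := by
    calc _ ≤ ((D * N ^ k) ^ 2) ^ k := by gcongr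
      _ = D ^ (2 * k) * N ^ K := by
          rw [← pow_mul, mul_pow, ← pow_mul, hK]; ring_nf
  calc _ ≤ s ^ 2 * ((N ^ m) ^ K * ((s * N) ^ m * (D ^ (2 * k) * N ^ K))) := by gcongr
    _ = C * ((N ^ m) ^ K * N ^ m * N ^ K) := by rw [hC, mul_pow]; ring
    _ < N * ((N ^ m) ^ K * N ^ m * N ^ K) :=
        Nat.mul_lt_mul_of_pos_right (Nat.lt_succ_self C) (by positivity)
    _ = (N ^ m) ^ K * N ^ m * (N ^ K * N) := by ring
    _ = (N ^ m) ^ s := by rw [← pow_succ N K, ← hm, hs, pow_add (N ^ m) K 2, sq, mul_assoc]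

/-! ### No deterministic automaton with `k` heads recognizes the separating language -/

section LowerBound

variable {Γ : Type} {k : ℕ}

theorem mem_language_blockWord_iff (M : DetFA Γ k) (α β : Γ) (m n s : ℕ) (V : ℕ → ZMod m → ℕ)
    (z : ZMod m → ℕ) : blockWord α β m n s V z ∈ M.language ↔
      M.TapeAccepts (m * (s * n + s * n)) (DetFA.symbolAt (blockWord α β m n s V z)) := by
  rw [M.mem_language_iff_tapeAccepts, length_blockWord]

/-- A finite table of values as a function on the natural numbers. -/
def tableValue {m n s : ℕ} (v : Fin s → ZMod m → Fin (n + 1)) (t : ℕ) (i : ZMod m) : ℕ :=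
  if h : t < s then v ⟨t, h⟩ i else 0

theorem tableValue_le {m n s : ℕ} (v : Fin s → ZMod m → Fin (n + 1)) (t : ℕ) (i : ZMod m) :
    tableValue v t i ≤ n := by
  unfold tableValue; split_ifs
  · exact Nat.lt_succ_iff.1 (v _ i).2
  · exact Nat.zero_le _

theorem tableValue_congr {m n s : ℕ} {v v' : Fin s → ZMod m → Fin (n + 1)} {j : Fin s}
    (h : ∀ t, t ≠ j → v t = v' t) (t : ℕ) (ht : t ≠ j) : tableValue v t = tableValue v' t := by
  funext i
  unfold tableValue
  split_ifs with hlt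
  · rw [h ⟨t, hlt⟩ (fun h' => ht (congrArg Fin.val h'))]
  · rfl

theorem sum_range_tableValue {m n s : ℕ} (v : Fin s → ZMod m → Fin (n + 1)) (i : ZMod m) :
    ∑ t ∈ Finset.range s, tableValue v t i = ∑ t, (v t i : ℕ) := by
  rw [Finset.sum_range]
  exact Finset.sum_congr rfl fun t _ => by simp [tableValue]

/-- The numbers that complete the column sums of a table to the maximum. -/
def complement {m n s : ℕ} (v : Fin s → ZMod m → Fin (n + 1)) (i : ZMod m) : ℕ :=
  s * n - ∑ t, (v t i : ℕ)

theorem complement_le {m n s : ℕ} (v : Fin s → ZMod m → Fin (n + 1)) (i : ZMod m) :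
    complement v i ≤ s * n :=
  Nat.sub_le _ _

theorem sum_le {m n s : ℕ} (v : Fin s → ZMod m → Fin (n + 1)) (i : ZMod m) :
    ∑ t, (v t i : ℕ) ≤ s * n := by
  calc _ ≤ ∑ _t : Fin s, n := Finset.sum_le_sum fun t _ => Nat.lt_succ_iff.1 (v t i).2
    _ = s * n := by simp

/-- Two tables with the same column sums that differ only in two rows are equal, if the balanced
words built from them are accepted with the same separated blocks and the same entries. -/
theorem eq_of_entry_eq {α β : Γ} (hαβ : β ≠ α) {m : ℕ} [NeZero m] {M : DetFA Γ k}
    (hM : M.language = balanced α m) {n s : ℕ} (hn : 0 < n)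
    {v v' : Fin s → ZMod m → Fin (n + 1)} {i j : Fin s}
    (hout : ∀ t, t ≠ i → t ≠ j → v t = v' t) (hz : complement v = complement v')
    (hs : M.Separates (m * (s * n + s * n)) (blockOf m n)
      (DetFA.symbolAt (blockWord α β m n s (tableValue v) (complement v))) (i + 1) (j + 1))
    (hs' : M.Separates (m * (s * n + s * n)) (blockOf m n)
      (DetFA.symbolAt (blockWord α β m n s (tableValue v') (complement v'))) (i + 1) (j + 1))
    (hent : ∀ h, ∀ b ∈ [i, j], M.entry (m * (s * n + s * n)) (blockOf m n)
      (DetFA.symbolAt (blockWord α β m n s (tableValue v) (complement v))) (b + 1) h =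
      M.entry (m * (s * n + s * n)) (blockOf m n)
      (DetFA.symbolAt (blockWord α β m n s (tableValue v') (complement v'))) (b + 1) h) :
    v = v' := by
  have hmn : 0 < m * n := Nat.mul_pos (NeZero.pos m) hn
  have hacc : ∀ u : Fin s → ZMod m → Fin (n + 1), M.TapeAccepts (m * (s * n + s * n))
      (DetFA.symbolAt (blockWord α β m n s (tableValue u) (complement u))) := by
    intro u
    rw [← mem_language_blockWord_iff, hM,
      blockWord_mem_balanced_iff hαβ (tableValue_le u) (complement_le u)]
    intro r
    rw [sum_range_tableValue, complement]
    have := sum_le u r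
    omega
  -- The hybrid takes row `j` from `v'` and every other row from `v`; it agrees with `v'` outside
  -- row `i`.
  set u := Function.update v j (v' j) with hu
  have huv : ∀ t, t ≠ j → u t = v t := fun t ht => Function.update_of_ne ht _ _
  have huv' : ∀ t, t ≠ i → u t = v' t := by
    intro t ht
    by_cases htj : t = j
    · rw [htj, hu, Function.update_self]
    · rw [huv t htj, hout t ht htj]
  have hmix : M.TapeAccepts (m * (s * n + s * n))
      (DetFA.symbolAt (blockWord α β m n s (tableValue u) (complement v))) := by
    refine DetFA.tapeAccepts_mix (monotone_blockOf m n) (i := i + 1) (j := j + 1)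
      (by rw [blockOf_zero hmn]; omega) (fun p hp => ?_) (fun p hp => ?_) hs hs'
      (fun h => hent h i (by simp)) (fun h => hent h j (by simp)) (hacc v) (hacc v')
    · exact symbolAt_blockWord_congr hmn (tableValue_congr huv) hp
    · rw [hz]
      exact symbolAt_blockWord_congr hmn (tableValue_congr huv') hp
  rw [← mem_language_blockWord_iff, hM,
    blockWord_mem_balanced_iff hαβ (tableValue_le u) (complement_le v)] at hmix
  -- Acceptance makes the hybrid balanced with the padding of `v`, so it has the same column sums as
  -- `v`.
  have hsum : ∀ r, ∑ t, (u t r : ℕ) = ∑ t, (v t r : ℕ) := by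
    intro r
    have h1 := hmix r
    rw [sum_range_tableValue, complement] at h1
    have := sum_le v r
    omega
  have hsum' : ∀ r, ∑ t, (v t r : ℕ) = ∑ t, (v' t r : ℕ) := by
    intro r
    have h1 := congrFun hz r
    have := sum_le v r
    have := sum_le v' r
    simp only [complement] at h1
    omega
  -- Tables that differ in at most one row and have equal column sums are equal. Applied to `u` and
  -- `v`, and then to `v` and `v'`, this identifies the two tables.
  have hrow : ∀ (a b : Fin s → ZMod m → Fin (n + 1)) (j : Fin s), (∀ t, t ≠ j → a t = b t) →
      (∀ r, ∑ t, (a t r : ℕ) = ∑ t, (b t r : ℕ)) → a = b := by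
    intro a b j hab hs
    funext t
    by_cases ht : t = j
    · subst ht
      funext r
      have h1 := hs r
      rw [← Finset.add_sum_erase _ _ (Finset.mem_univ t),
        ← Finset.add_sum_erase (a := t) _ (fun t => (b t r : ℕ)) (Finset.mem_univ t),
        Finset.sum_congr rfl (fun x hx => by rw [hab x (Finset.ne_of_mem_erase hx)])] at h1
      exact Fin.ext (Nat.add_right_cancel h1)
    · exact hab t ht
  have h1 : u = v := hrow u v j huv hsum
  exact hrow v v' i (fun t ht => by rw [← h1, huv' t ht]) hsum'

theorem balanced_notMem_detClass {α β : Γ} (hαβ : β ≠ α) (k : ℕ) :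
    balanced α (2 * k * k + 1) ∉ detClass Γ k := by
  classical
  rintro ⟨M, hM⟩
  let _ := M.fintypeQ
  obtain ⟨n, hn, hlt⟩ := exists_card_bound k (Fintype.card M.Q)
  obtain ⟨m, hm⟩ : ∃ m, m = 2 * k * k + 1 := ⟨_, rfl⟩
  obtain ⟨s, hs⟩ : ∃ s, s = 2 * k * k + 2 := ⟨_, rfl⟩
  rw [← hm] at hM hlt
  rw [← hs] at hlt
  have : NeZero m := ⟨by omega⟩
  set L := m * (s * n + s * n) with hL
  set f : (Fin s → ZMod m → Fin (n + 1)) → ℕ → TapeSymbol Γ := fun v =>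
    DetFA.symbolAt (blockWord α β m n s (tableValue v) (complement v)) with hf
  have hsep := fun v => DetFA.exists_separates (M := M) (L := L) (monotone_blockOf m n) (f v)
    (s := s) (by omega)
  choose pr hne hpr using hsep
  -- Some pair of blocks is the chosen separated pair of more tables than there are possible values
  -- of the data `Φ` below: the other rows, the padding, and all first entries into the two blocks.
  obtain ⟨p, hp⟩ := Fintype.exists_lt_card_fiber_of_mul_lt_card pr
    (n := ((n + 1) ^ m) ^ (2 * k * k) *
      ((s * n + 1) ^ m * ((Fintype.card M.Q * (L + 2) ^ k + 1) ^ 2) ^ k)) (by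
      simpa [ZMod.card, ← sq] using hlt)
  rcases eq_or_ne p.1 p.2 with hp12 | hp12
  · have : (Finset.univ.filter fun v => pr v = p) = ∅ := by
      refine Finset.filter_eq_empty_iff.2 fun v _ hv => hne v ?_
      rw [hv, hp12]
    rw [this] at hp
    simp at hp
  · set Φ : (Fin s → ZMod m → Fin (n + 1)) →
        (({p.1, p.2}ᶜ : Finset (Fin s)) → ZMod m → Fin (n + 1)) × (ZMod m → Fin (s * n + 1)) ×
        (Fin k → Fin 2 → Option (M.Q × (Fin k → Fin (L + 2)))) := fun v =>
      (fun t => v t, fun r => ⟨complement v r, Nat.lt_succ_of_le (complement_le v r)⟩,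
        fun h => ![M.entry L (blockOf m n) (f v) (p.1 + 1) h,
          M.entry L (blockOf m n) (f v) (p.2 + 1) h]) with hΦ
    obtain ⟨v, hv, v', hv', hvv', heq⟩ := Finset.exists_ne_map_eq_of_card_lt_of_maps_to
      (s := Finset.univ.filter fun v => pr v = p) (t := Finset.univ) (f := Φ)
      (by
        refine lt_of_eq_of_lt ?_ hp
        have : Fintype.card ({p.1, p.2}ᶜ : Finset (Fin s)) = 2 * k * k := by
          rw [Fintype.card_coe, Finset.card_compl, Finset.card_pair hp12, Fintype.card_fin, hs, Nat.add_sub_cancel]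
        rw [Finset.card_univ, Fintype.card_prod, Fintype.card_fun, this]
        simp [ZMod.card])
      (fun _ _ => Finset.mem_coe.2 (Finset.mem_univ _))
    rw [Finset.mem_filter] at hv hv'
    simp only [hΦ, Prod.mk.injEq] at heq
    obtain ⟨h1, h2, h3⟩ := heq
    refine hvv' (eq_of_entry_eq (i := p.1) (j := p.2) hαβ hM hn (fun t ht1 ht2 => ?_) (funext fun r => ?_)
      ?_ ?_ fun h b hb => ?_)
    · exact congrFun h1 ⟨t, by simp [ht1, ht2]⟩
    · exact congrArg Fin.val (congrFun h2 r)
    · rw [← hv.2]; exact hpr v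
    · rw [← hv'.2]; exact hpr v'
    · have h4 := congrFun h3 h
      simp only [List.mem_cons, List.not_mem_nil, or_false] at hb
      rcases hb with rfl | rfl
      · exact congrFun h4 0
      · exact congrFun h4 1

end LowerBound

end MultiheadFA

/-! ### The proper inclusions -/

theorem mainTheorem12 (Γ : Type) [Finite Γ] (k : ℕ) (ε : ℝ) (hε₀ : 0 < ε) (hε : ε < 1 / 2) :
    (1 ≤ k →
      MultiheadFA.detClass Γ k ⊆ MultiheadFA.quantumClass Γ k ε ∧
      (Nontrivial Γ → MultiheadFA.detClass Γ k ⊂ MultiheadFA.quantumClass Γ k ε)) ∧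
    (3 ≤ k →
      MultiheadFA.detClass Γ k ⊆ MultiheadFA.probClass Γ k ε ∧
      (Nontrivial Γ → MultiheadFA.detClass Γ k ⊂ MultiheadFA.probClass Γ k ε)) := by
  refine ⟨fun hk => ⟨MultiheadFA.detClass_subset_quantumClass Γ k hε₀, fun hΓ => ?_⟩,
    fun hk => ⟨MultiheadFA.detClass_subset_probClass Γ k hε₀, fun hΓ => ?_⟩⟩
  · obtain ⟨α, β, hαβ⟩ := exists_pair_ne Γ
    refine ⟨MultiheadFA.detClass_subset_quantumClass Γ k hε₀, fun h => ?_⟩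
    refine MultiheadFA.balanced_notMem_detClass hαβ.symm k (h ?_)
    obtain ⟨l, rfl⟩ := Nat.exists_eq_add_of_le' hk
    exact MultiheadFA.balanced_mem_quantumClass α _ l hε₀
  · obtain ⟨α, β, hαβ⟩ := exists_pair_ne Γ
    refine ⟨MultiheadFA.detClass_subset_probClass Γ k hε₀, fun h => ?_⟩
    refine MultiheadFA.balanced_notMem_detClass hαβ.symm k (h ?_)
    obtain ⟨l, rfl⟩ := Nat.exists_eq_add_of_le' hk
    exact MultiheadFA.balanced_mem_probClass α _ l hε₀
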